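/- Let $c>1$ be a real number that is not an integer. There exist constants $\theta>0$, $\delta>0$ and $C$, depending only on $c$, such that for all positive integers $N$ and all integers $m,u$ with $1\le m\le N^{\theta}$ and $0\le u<m$, $$\Bigl|\sum_{\substack{1\le n\le N\\ \lfloor n^c\rfloor\equiv u \bmod m}}\Lambda(n)-\frac{\Psi(N)}{m}\Bigr|\le C\Bigl(\frac{N}{m}\Bigr)^{1-\delta},$$ where $\Lambda$ is the von Mangoldt function ($\Lambda(p^k)=\log p$ for primes $p$ and $k\ge1$, and $\Lambda(n)=0$ otherwise) and $\Psi(N)=\sum_{n\le N}\Lambda(n)$. -/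

import Mathlib

/-! The congruence `⌊n^c⌋ ≡ u mod m` says that the fractional part of `(n^c - u)/m` is below `1/m`
(`floor_modEq_iff_fract_lt`). So the theorem is an equidistribution statement, weighted by `Λ`, for
the points `n^c/m` in an arc of length `1/m`. Sums of translated Fejér kernels approximate the arc,
and the error is controlled by the sums `∑ Λ(n) e(α n^c)` with `α = k/m`
(`abs_sum_fract_lt_sub_le`). For `m` and `k` at most small powers of `N`, a saving of a power of `N`
is needed for `N^(-θ) ≤ α ≤ N^θ`.

This saving (`exists_norm_sum_vonMangoldt_le`) comes from Vaughan's identity with cutoff about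
`N^(1/8)`. The type I sums contain `∑ e(α k^c l^c)` over `l`. Cauchy–Schwarz turns the type II sums
into `∑ e(α (k^c - k'^c) l^c)`. Both are sums `∑ e(β l^c)` over intervals, whose length is at most
some `X ≥ N^(1/8)`, with `|β|` between `N^(-θ)` and `N^(θ+c)`, and a bound smaller than `X` by a
power of `N` is enough.

For such a sum (`exists_norm_sum_rpow_le`), consider a block at height `Y`. The `k`-th difference of
`β n^c` has size about `|β| Y^(c-k)`, with leading factor `c(c-1)...(c-k+1)`, nonzero because `c` is
not an integer. Some `k ≥ 2` puts this size between `Y^(-5/4)` and `Y^(-1/4)`, and there van der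
Corput's `k`-th difference test (`exists_norm_sum_ePhase_le`) saves a power of `Y`.

Finally, as `m` is at most a small power of `N`, a power saving over `N` is also one over `N/m`. -/

section

open Finset Real

open scoped ArithmeticFunction.Moebius ArithmeticFunction.zeta ArithmeticFunction.vonMangoldt

/-! ### The additive character on the real line -/

/-- The additive character `x ↦ exp (2 π i x)`. -/
noncomputable def ePhase (x : ℝ) : ℂ := Complex.exp ((2 * π * x : ℝ) * Complex.I)

@[simp] lemma norm_ePhase (x : ℝ) : ‖ePhase x‖ = 1 := Complex.norm_exp_ofReal_mul_I _

@[simp] lemma ePhase_zero : ePhase 0 = 1 := by simp [ePhase]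

lemma ePhase_add (x y : ℝ) : ePhase (x + y) = ePhase x * ePhase y := by
  simp only [ePhase, ← Complex.exp_add]
  congr 1
  push_cast
  ring

lemma ePhase_neg (x : ℝ) : ePhase (-x) = (starRingEnd ℂ) (ePhase x) := by
  simp only [ePhase, ← Complex.exp_conj]
  congr 1
  rw [map_mul, Complex.conj_ofReal, Complex.conj_I]
  push_cast
  ring

lemma ePhase_sub (x y : ℝ) : ePhase (x - y) = ePhase x * (starRingEnd ℂ) (ePhase y) := by
  rw [sub_eq_add_neg, ePhase_add, ePhase_neg]

lemma ePhase_int (k : ℤ) : ePhase k = 1 := by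
  rw [ePhase, Complex.exp_eq_one_iff]
  exact ⟨k, by push_cast; ring⟩

lemma ePhase_add_int (x : ℝ) (k : ℤ) : ePhase (x + k) = ePhase x := by
  rw [ePhase_add, ePhase_int, mul_one]

lemma ePhase_nat_mul (n : ℕ) (x : ℝ) : ePhase (n * x) = ePhase x ^ n := by
  simp only [ePhase, ← Complex.exp_nat_mul]
  congr 1
  push_cast
  ring

lemma norm_one_sub_ePhase (x : ℝ) : ‖1 - ePhase x‖ = 2 * |sin (π * x)| := by
  rw [norm_sub_rev, ePhase, mul_comm, Complex.norm_exp_I_mul_ofReal_sub_one]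
  rw [show 2 * π * x / 2 = π * x by ring]
  simp

lemma norm_ePhase_sub_le (x y : ℝ) : ‖ePhase x - ePhase y‖ ≤ 2 * π * |x - y| := by
  have h' : ePhase x - ePhase y = ePhase x * (1 - ePhase (y - x)) := by
    rw [mul_sub, ← ePhase_add, mul_one, add_sub_cancel]
  rw [h', norm_mul, norm_ePhase, one_mul, norm_one_sub_ePhase]
  have := abs_sin_le_abs (x := π * (y - x))
  rw [abs_mul, abs_of_pos pi_pos, abs_sub_comm] at this
  linarith

/-- Jordan's inequality for the sine, used directly on the first half of the period and after
reflection on the second. -/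
lemma le_norm_one_sub_ePhase {x D : ℝ} (j : ℤ) (hD : 0 ≤ D) (h1 : j + D ≤ x)
    (h2 : x ≤ j + 1 - D) : 4 * D ≤ ‖1 - ePhase x‖ := by
  have hx : ePhase x = ePhase (x - j) := by
    rw [← ePhase_add_int (x - j) j]; ring_nf
  rw [hx, norm_one_sub_ePhase]
  set t := x - j with ht
  have ht1 : D ≤ t := by linarith
  have ht2 : t ≤ 1 - D := by linarith
  have hp := pi_pos
  have key : 2 * D ≤ sin (π * t) := by
    rcases le_total t (1 / 2) with h | h
    · have := mul_le_sin (x := π * t) (mul_nonneg hp.le (by linarith)) (by nlinarith)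
      have e : 2 / π * (π * t) = 2 * t := by field_simp
      linarith
    · have := mul_le_sin (x := π * (1 - t)) 
        (mul_nonneg hp.le (by linarith)) (by nlinarith)
      have e : 2 / π * (π * (1 - t)) = 2 * (1 - t) := by field_simp
      have e2 : sin (π * (1 - t)) = sin (π * t) := by
        rw [show π * (1 - t) = π - π * t by ring, sin_pi_sub]
      linarith
  linarith [le_abs_self (sin (π * t))]

/-! ### First and second difference tests -/

/-- A crude form of the Kusmin–Landau inequality. -/
lemma norm_sum_ePhase_le_of_diff {f : ℕ → ℝ} {M : ℕ} {D : ℝ} (j : ℤ) (hD : 0 < D)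
    (hD2 : D ≤ 1 / 2)
    (h1 : ∀ n < M, j + D ≤ f (n + 1) - f n) (h2 : ∀ n < M, f (n + 1) - f n ≤ j + 1 - D)
    (hmono : ∀ n, n + 1 < M → f (n + 1) - f n ≤ f (n + 2) - f (n + 1)) :
    ‖∑ n ∈ range M, ePhase (f n)‖ ≤ 1 / D ^ 2 := by
  rcases M with _ | M
  · simp; positivity
  -- Each term is `w n` times a difference of consecutive terms, so summation by parts applies. The
  -- variation of `w` is at most a Lipschitz constant times the total increase of the monotone
  -- differences, which is at most 1; this gives `1 / D ^ 2`.
  set w : ℕ → ℂ := fun n => (1 - ePhase (f (n + 1) - f n))⁻¹ with hw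
  have hlow : ∀ n < M + 1, 4 * D ≤ ‖1 - ePhase (f (n + 1) - f n)‖ := fun n hn =>
    le_norm_one_sub_ePhase j hD.le (h1 n hn) (h2 n hn)
  have hne : ∀ n < M + 1, 1 - ePhase (f (n + 1) - f n) ≠ 0 := fun n hn h => by
    have := hlow n hn
    rw [h, norm_zero] at this
    linarith
  have hwn : ∀ n < M + 1, ‖w n‖ ≤ 1 / (4 * D) := fun n hn => by
    rw [hw, norm_inv, ← one_div]
    exact one_div_le_one_div_of_le (by positivity) (hlow n hn)
  have hstep : ∀ n < M + 1, ePhase (f n) = (ePhase (f n) - ePhase (f (n + 1))) * w n := by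
    intro n hn
    have : ePhase (f n) - ePhase (f (n + 1)) = ePhase (f n) * (1 - ePhase (f (n + 1) - f n)) := by
      rw [mul_sub, ← ePhase_add]; ring_nf
    rw [this, mul_assoc, hw, mul_inv_cancel₀ (hne n hn), mul_one]
  have hparts : ∀ K < M + 1, ∑ n ∈ range (K + 1), ePhase (f n) =
      ePhase (f 0) * w 0 - ePhase (f (K + 1)) * w K +
        ∑ n ∈ range K, ePhase (f (n + 1)) * (w (n + 1) - w n) := by
    intro K
    induction K with
    | zero => intro _; rw [sum_range_one, sum_range_zero]; linear_combination hstep 0 (by omega)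
    | succ K ih =>
      intro hK
      rw [sum_range_succ, ih (by omega), sum_range_succ _ K]
      linear_combination hstep (K + 1) hK
  rw [hparts M (by omega)]
  have hdiff : ∀ n < M, ‖ePhase (f (n + 1)) * (w (n + 1) - w n)‖ ≤
      2 * π / (4 * D) ^ 2 * ((f (n + 2) - f (n + 1)) - (f (n + 1) - f n)) := by
    intro n hn
    have hm := hmono n (by omega)
    have e1 : w (n + 1) - w n = (ePhase (f (n + 2) - f (n + 1)) - ePhase (f (n + 1) - f n)) *
        (w (n + 1) * w n) := by
      have a1 := hne n (by omega)
      have a2 := hne (n + 1) (by omega)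
      simp only [hw]
      rw [show n + 1 + 1 = n + 2 from rfl] at a2 ⊢
      field_simp
      ring
    rw [norm_mul, norm_ePhase, one_mul, e1, norm_mul, norm_mul]
    have b1 := norm_ePhase_sub_le (f (n + 2) - f (n + 1)) (f (n + 1) - f n)
    rw [abs_of_nonneg (by linarith)] at b1
    have b2 := mul_le_mul (hwn (n + 1) (by omega)) (hwn n (by omega)) (norm_nonneg _)
      (by positivity)
    calc _ ≤ _ := mul_le_mul b1 b2 (by positivity) ((norm_nonneg _).trans b1)
      _ = _ := by field_simp
  have hsum : ‖∑ n ∈ range M, ePhase (f (n + 1)) * (w (n + 1) - w n)‖ ≤ 2 * π / (4 * D) ^ 2 := by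
    refine (norm_sum_le _ _).trans ((sum_le_sum fun n hn => hdiff n (mem_range.1 hn)).trans ?_)
    rw [← mul_sum, sum_range_sub (fun n => f (n + 1) - f n)]
    have c1 := h1 0 (by omega)
    have c2 := h2 M (by omega)
    have : 0 ≤ 2 * π / (4 * D) ^ 2 := by positivity
    have c3 : (f (M + 1) - f M) - (f (0 + 1) - f 0) ≤ 1 := by linarith
    nlinarith
  have t1 : ‖ePhase (f 0) * w 0‖ ≤ 1 / (4 * D) := by
    rw [norm_mul, norm_ePhase, one_mul]; exact hwn 0 (by omega)
  have t2 : ‖ePhase (f (M + 1)) * w M‖ ≤ 1 / (4 * D) := by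
    rw [norm_mul, norm_ePhase, one_mul]; exact hwn M (by omega)
  have t3 := (norm_add_le _ _).trans (add_le_add ((norm_sub_le _ _).trans (add_le_add t1 t2)) hsum)
  refine t3.trans ?_
  have hpi := pi_lt_four
  have : 1 / (4 * D) + 1 / (4 * D) + 2 * π / (4 * D) ^ 2 = (D / 2 + π / 8) / D ^ 2 := by
    field_simp
    ring
  rw [this]
  gcongr
  linarith

lemma card_le_of_diff_separated {d : ℕ → ℝ} {M : ℕ} {lam D x : ℝ} (hlam : 0 < lam) (hD : 0 ≤ D)
    (hd : ∀ n, n + 1 < M → lam ≤ d (n + 1) - d n) {T : Finset ℕ} (hT : T ⊆ range M)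
    (hx : ∀ n ∈ T, x ≤ d n ∧ d n ≤ x + D) : (T.card : ℝ) ≤ D / lam + 1 := by
  rcases T.eq_empty_or_nonempty with rfl | hne
  · simp; positivity
  have hgrow : ∀ k n, n + k < M → k * lam ≤ d (n + k) - d n := by
    intro k
    induction k with
    | zero => intro n _; simp
    | succ k ih =>
      intro n hn
      have := ih n (by omega)
      have := hd (n + k) (by omega)
      push_cast
      rw [← add_assoc]
      linarith
  have hle := T.min'_le_max' hne
  have hmin := hx _ (T.min'_mem hne)
  have hmax := hx _ (T.max'_mem hne)
  obtain ⟨k, hk⟩ := Nat.exists_eq_add_of_le hle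
  have hM := mem_range.1 (hT (T.max'_mem hne))
  have h1 := hgrow k (T.min' hne) (by omega)
  rw [← hk] at h1
  have hc : T.card ≤ k + 1 := by
    have : T ⊆ Icc (T.min' hne) (T.max' hne) := fun n hn =>
      mem_Icc.2 ⟨T.min'_le n hn, T.le_max' n hn⟩
    have := card_le_card this
    rw [Nat.card_Icc] at this
    omega
  have h2 : (k : ℝ) ≤ D / lam := by
    rw [le_div_iff₀ hlam]; linarith
  have : (T.card : ℝ) ≤ k + 1 := by exact_mod_cast hc
  linarith

lemma norm_sum_ePhase_le_card (T : Finset ℕ) (f : ℕ → ℝ) :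
    ‖∑ n ∈ T, ePhase (f n)‖ ≤ T.card := by
  refine (norm_sum_le _ _).trans ?_
  simp

/-- Second-difference test, in terms of a free parameter `D`. -/
lemma norm_sum_ePhase_second_diff {f : ℕ → ℝ} {M : ℕ} {lam A D : ℝ} (hlam : 0 < lam)
    (hD : 0 < D) (hD2 : D ≤ 1 / 2)
    (h1 : ∀ n < M, lam ≤ (f (n + 2) - f (n + 1)) - (f (n + 1) - f n))
    (h2 : ∀ n < M, (f (n + 2) - f (n + 1)) - (f (n + 1) - f n) ≤ A * lam) :
    ‖∑ n ∈ range M, ePhase (f n)‖ ≤ (A * lam * M + 2) * (2 * (D / lam + 1) + 1 / D ^ 2) := by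
  rcases M.eq_zero_or_pos with rfl | hM
  · simp; positivity
  set d : ℕ → ℝ := fun n => f (n + 1) - f n with hd
  have hd1 : ∀ n, n + 1 < M → lam ≤ d (n + 1) - d n := fun n hn => h1 n (by omega)
  have hmono : ∀ k n, n + k < M → d n ≤ d (n + k) := by
    intro k
    induction k with
    | zero => intro n _; simp
    | succ k ih =>
      intro n hn
      have := ih n (by omega)
      have := hd1 (n + k) (by omega)
      rw [← add_assoc]
      linarith
  have hmono' : ∀ a b, a ≤ b → b < M → d a ≤ d b := by
    intro a b hab hb
    obtain ⟨k, rfl⟩ := Nat.exists_eq_add_of_le hab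
    exact hmono k a hb
  have hup : ∀ k, k < M → d k - d 0 ≤ A * lam * k := by
    intro k
    induction k with
    | zero => intro _; simp
    | succ k ih =>
      intro hn
      have := ih (by omega)
      have := h2 k (by omega)
      simp only [hd] at *
      push_cast
      rw [show k + 1 + 1 = k + 2 from rfl]
      linarith
  -- The indices are grouped by the integer part `j` of the first difference `d n`. Where `d n` is
  -- within `D` of `j` or `j + 1`, the terms are counted: `d` grows by at least `lam` each time. The
  -- remaining indices form an interval, since `d` is monotone, and Kusmin–Landau applies there.
  set J := Icc ⌊d 0⌋ ⌊d (M - 1)⌋ with hJ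
  have hmaps : ∀ n ∈ range M, ⌊d n⌋ ∈ J := by
    intro n hn
    have hn := mem_range.1 hn
    exact mem_Icc.2 ⟨Int.floor_le_floor (hmono' 0 n (by omega) hn),
      Int.floor_le_floor (hmono' n (M - 1) (by omega) (by omega))⟩
  have hA : 0 ≤ A * lam := hlam.le.trans ((h1 0 hM).trans (h2 0 hM))
  have hJcard : (J.card : ℝ) ≤ A * lam * M + 2 := by
    rw [hJ, Int.card_Icc]
    have hfl : ⌊d 0⌋ ≤ ⌊d (M - 1)⌋ := Int.floor_le_floor (hmono' 0 (M - 1) (by omega) (by omega))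
    have e : (((⌊d (M - 1)⌋ + 1 - ⌊d 0⌋).toNat : ℕ) : ℝ) = ⌊d (M - 1)⌋ + 1 - ⌊d 0⌋ := by
      have : (((⌊d (M - 1)⌋ + 1 - ⌊d 0⌋).toNat : ℕ) : ℤ) = ⌊d (M - 1)⌋ + 1 - ⌊d 0⌋ :=
        Int.toNat_of_nonneg (by omega)
      exact_mod_cast this
    rw [e]
    have := hup (M - 1) (by omega)
    have a1 := Int.floor_le (d (M - 1))
    have a2 := Int.lt_floor_add_one (d 0)
    have a3 : A * lam * ((M - 1 : ℕ) : ℝ) ≤ A * lam * M := by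
      gcongr
      omega
    linarith
  have hfib : ∀ j ∈ J, ‖∑ n ∈ range M with ⌊d n⌋ = j, ePhase (f n)‖ ≤
      2 * (D / lam + 1) + 1 / D ^ 2 := by
    intro j _
    set S := (range M).filter (fun n => ⌊d n⌋ = j) with hS
    have hSd : ∀ n ∈ S, n < M ∧ (j : ℝ) ≤ d n ∧ d n < j + 1 := by
      intro n hn
      rw [hS, mem_filter, mem_range] at hn
      refine ⟨hn.1, ?_, ?_⟩
      · rw [← hn.2]; exact Int.floor_le _
      · rw [← hn.2]; exact Int.lt_floor_add_one _
    have hSr : S ⊆ range M := filter_subset _ _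
    rw [← sum_filter_add_sum_filter_not S (fun n => d n < j + D)]
    rw [← sum_filter_add_sum_filter_not (S.filter (fun n => ¬ d n < j + D))
      (fun n => j + 1 - D < d n)]
    have b1 : ‖∑ n ∈ S with d n < j + D, ePhase (f n)‖ ≤ D / lam + 1 := by
      refine (norm_sum_ePhase_le_card _ _).trans
        (card_le_of_diff_separated (x := j) hlam hD.le hd1 ((filter_subset _ _).trans hSr) ?_)
      intro n hn
      rw [mem_filter] at hn
      exact ⟨(hSd n hn.1).2.1, hn.2.le⟩
    have b2 : ‖∑ n ∈ (S.filter (fun n => ¬ d n < j + D)) with j + 1 - D < d n, ePhase (f n)‖ ≤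
        D / lam + 1 := by
      refine (norm_sum_ePhase_le_card _ _).trans
        (card_le_of_diff_separated (x := j + 1 - D) hlam hD.le hd1
          ((filter_subset _ _).trans ((filter_subset _ _).trans hSr)) ?_)
      intro n hn
      rw [mem_filter, mem_filter] at hn
      refine ⟨hn.2.le, ?_⟩
      have := (hSd n hn.1.1).2.2
      linarith
    have b3 : ‖∑ n ∈ (S.filter (fun n => ¬ d n < j + D)) with ¬ (j + 1 - D < d n), ePhase (f n)‖ ≤
        1 / D ^ 2 := by
      set T := (S.filter (fun n => ¬ d n < j + D)).filter (fun n => ¬ (j + 1 - D < d n)) with hT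
      have hTm : ∀ n, n ∈ T ↔ n < M ∧ j + D ≤ d n ∧ d n ≤ j + 1 - D := by
        intro n
        rw [hT, mem_filter, mem_filter, not_lt, not_lt]
        constructor
        · rintro ⟨⟨a, b⟩, c⟩
          exact ⟨(hSd n a).1, b, c⟩
        · rintro ⟨a, b, c⟩
          refine ⟨⟨?_, b⟩, c⟩
          rw [hS, mem_filter, mem_range]
          exact ⟨a, Int.floor_eq_iff.2 ⟨by linarith, by linarith⟩⟩
      rcases T.eq_empty_or_nonempty with h0 | hne
      · rw [h0, sum_empty, norm_zero]; positivity
      have hTeq : T = Ico (T.min' hne) (T.max' hne + 1) := by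
        ext n
        constructor
        · intro hn
          exact mem_Ico.2 ⟨T.min'_le n hn, Nat.lt_succ_of_le (T.le_max' n hn)⟩
        · intro hn
          rw [mem_Ico] at hn
          have m1 := (hTm _).1 (T.min'_mem hne)
          have m2 := (hTm _).1 (T.max'_mem hne)
          refine (hTm n).2 ⟨by omega, m1.2.1.trans (hmono' _ _ hn.1 (by omega)),
            (hmono' _ _ (by omega) m2.1).trans m2.2.2⟩
      obtain ⟨a, b, hab⟩ : ∃ a b, T = Ico a b := ⟨_, _, hTeq⟩
      have hin : ∀ n < b - a, a + n ∈ T := by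
        intro n hn
        rw [hab, mem_Ico]
        omega
      rw [hab, sum_Ico_eq_sum_range]
      refine norm_sum_ePhase_le_of_diff (f := fun n => f (a + n)) j hD hD2 ?_ ?_ ?_
      · intro n hn
        exact ((hTm _).1 (hin n hn)).2.1
      · intro n hn
        exact ((hTm _).1 (hin n hn)).2.2
      · intro n hn
        have := hd1 (a + n) ((hTm _).1 (hin (n + 1) hn)).1
        simp only [hd] at this
        rw [show a + (n + 1) = a + n + 1 by ring,
          show a + (n + 2) = a + n + 1 + 1 by ring]
        linarith
    refine (norm_add_le _ _).trans ?_
    refine (add_le_add b1 ((norm_add_le _ _).trans (add_le_add b2 b3))).trans ?_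
    linarith
  rw [← sum_fiberwise_of_maps_to hmaps]
  refine (norm_sum_le _ _).trans ((sum_le_sum hfib).trans ?_)
  rw [sum_const, nsmul_eq_mul]
  gcongr

/-! ### Van der Corput's inequality and the higher difference tests -/

/-- Opening the square and exchanging sums; serves both van der Corput's inequality and the type II
sums. -/
lemma sum_norm_sq_sum_le {ι κ : Type*} (s : Finset ι) (t : Finset κ) (a : κ → ι → ℂ) :
    ∑ n ∈ s, ‖∑ k ∈ t, a k n‖ ^ 2 ≤
      ∑ k ∈ t, ∑ l ∈ t, ‖∑ n ∈ s, a k n * (starRingEnd ℂ) (a l n)‖ := by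
  have h : ((∑ n ∈ s, ‖∑ k ∈ t, a k n‖ ^ 2 : ℝ) : ℂ) =
      ∑ k ∈ t, ∑ l ∈ t, ∑ n ∈ s, a k n * (starRingEnd ℂ) (a l n) := by
    push_cast
    have : ∀ n ∈ s, ((‖∑ k ∈ t, a k n‖ : ℝ) : ℂ) ^ 2 =
        ∑ k ∈ t, ∑ l ∈ t, a k n * (starRingEnd ℂ) (a l n) := fun n _ => by
      rw [← Complex.mul_conj', map_sum, sum_mul_sum]
    rw [sum_congr rfl this, sum_comm]
    exact sum_congr rfl fun k _ => sum_comm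
  have h0 : 0 ≤ ∑ n ∈ s, ‖∑ k ∈ t, a k n‖ ^ 2 := sum_nonneg fun _ _ => by positivity
  calc _ = ‖((∑ n ∈ s, ‖∑ k ∈ t, a k n‖ ^ 2 : ℝ) : ℂ)‖ := by
        rw [Complex.norm_real, norm_of_nonneg h0]
    _ ≤ _ := by
        rw [h]
        exact (norm_sum_le _ _).trans (sum_le_sum fun k _ => norm_sum_le _ _)

/-- The van der Corput inequality, for a uniform bound on the correlations. -/
lemma vanDerCorput {z : ℕ → ℂ} {M H : ℕ} {B : ℝ} (hH : 0 < H) (hz : ∀ n, ‖z n‖ ≤ 1)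
    (hB : 0 ≤ B)
    (hcor : ∀ h, 1 ≤ h → h < H →
      ‖∑ n ∈ range (M - h), z (n + h) * (starRingEnd ℂ) (z n)‖ ≤ B) :
    ‖∑ n ∈ range M, z n‖ ^ 2 ≤ (M + H) * (M / H + B) := by
  -- `Z r` is `z`, extended by zero, translated by `r`. Averaging the `H` translates leaves the sum
  -- unchanged, and Cauchy–Schwarz over the `M + H` positions produces the correlations.
  set Z : ℕ → ℕ → ℂ := fun r n => if r ≤ n ∧ n < M + r then z (n - r) else 0 with hZ
  have hZsum : ∀ r ∈ range H, ∑ n ∈ range (M + H), Z r n = ∑ n ∈ range M, z n := by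
    intro r hr
    have hr := mem_range.1 hr
    rw [hZ, ← sum_filter]
    have : (range (M + H)).filter (fun n => r ≤ n ∧ n < M + r) = Ico r (M + r) := by
      ext n; simp only [mem_filter, mem_range, mem_Ico]; omega
    rw [this, sum_Ico_eq_sum_range]
    simp
  have hlt : ∀ r s, r < s → s < H →
      ‖∑ n ∈ range (M + H), Z r n * (starRingEnd ℂ) (Z s n)‖ ≤ B := by
    intro r s hrs hs
    have e : ∑ n ∈ range (M + H), Z r n * (starRingEnd ℂ) (Z s n) =
        ∑ n ∈ range (M - (s - r)), z (n + (s - r)) * (starRingEnd ℂ) (z n) := by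
      have e1 : ∀ n ∈ range (M + H), Z r n * (starRingEnd ℂ) (Z s n) =
          if s ≤ n ∧ n < M + r then z (n - r) * (starRingEnd ℂ) (z (n - s)) else 0 := by
        intro n _
        simp only [hZ]
        split_ifs <;> first | rfl | (exfalso; omega) | simp
      rw [sum_congr rfl e1, ← sum_filter]
      have : (range (M + H)).filter (fun n => s ≤ n ∧ n < M + r) = Ico s (M + r) := by
        ext n; simp only [mem_filter, mem_range, mem_Ico]; omega
      rw [this, sum_Ico_eq_sum_range, show M + r - s = M - (s - r) by omega]
      refine sum_congr rfl fun n _ => ?_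
      rw [show s + n - r = n + (s - r) by omega, show s + n - s = n by omega]
    rw [e]
    exact hcor _ (by omega) (by omega)
  have hall : ∀ r ∈ range H, ∀ s ∈ range H,
      ‖∑ n ∈ range (M + H), Z r n * (starRingEnd ℂ) (Z s n)‖ ≤ (if r = s then (M : ℝ) else 0) + B := by
    intro r hr s hs
    have hr := mem_range.1 hr
    have hs := mem_range.1 hs
    rcases lt_trichotomy r s with h | h | h
    · rw [if_neg h.ne, zero_add]; exact hlt r s h hs
    · subst h
      rw [if_pos rfl]
      have : ‖∑ n ∈ range (M + H), Z r n * (starRingEnd ℂ) (Z r n)‖ ≤ M := by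
        calc _ ≤ ∑ n ∈ range (M + H), (if r ≤ n ∧ n < M + r then (1 : ℝ) else 0) := by
              refine (norm_sum_le _ _).trans (sum_le_sum fun n _ => ?_)
              simp only [hZ]
              split_ifs
              · rw [norm_mul, RCLike.norm_conj]
                exact mul_le_one₀ (hz _) (norm_nonneg _) (hz _)
              · simp
          _ = M := by
              rw [← sum_filter]
              have : (range (M + H)).filter (fun n => r ≤ n ∧ n < M + r) = Ico r (M + r) := by
                ext n; simp only [mem_filter, mem_range, mem_Ico]; omega
              rw [this]; simp
      linarith
    · rw [if_neg h.ne', zero_add]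
      have e : ∑ n ∈ range (M + H), Z r n * (starRingEnd ℂ) (Z s n) =
          (starRingEnd ℂ) (∑ n ∈ range (M + H), Z s n * (starRingEnd ℂ) (Z r n)) := by
        rw [map_sum]
        refine sum_congr rfl fun n _ => ?_
        rw [map_mul, Complex.conj_conj, mul_comm]
      rw [e, RCLike.norm_conj]
      exact hlt s r h hr
  have hHS : (H : ℂ) * ∑ n ∈ range M, z n = ∑ n ∈ range (M + H), ∑ r ∈ range H, Z r n := by
    rw [sum_comm, sum_congr rfl hZsum]
    simp
  have hH' : (0 : ℝ) < H := by exact_mod_cast hH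
  have h1 : ((H : ℝ) * ‖∑ n ∈ range M, z n‖) ^ 2 ≤ (M + H) * (H * M + H ^ 2 * B) := by
    have : (H : ℝ) * ‖∑ n ∈ range M, z n‖ = ‖(H : ℂ) * ∑ n ∈ range M, z n‖ := by
      rw [norm_mul]; simp
    rw [this, hHS]
    calc _ ≤ (∑ n ∈ range (M + H), ‖∑ r ∈ range H, Z r n‖) ^ 2 := by
          gcongr
          exact norm_sum_le _ _
      _ ≤ (range (M + H)).card * ∑ n ∈ range (M + H), ‖∑ r ∈ range H, Z r n‖ ^ 2 :=
          sq_sum_le_card_mul_sum_sq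
      _ ≤ (M + H) * ∑ r ∈ range H, ∑ s ∈ range H, ((if r = s then (M : ℝ) else 0) + B) := by
          rw [card_range]
          push_cast
          gcongr
          exact (sum_norm_sq_sum_le _ _ _).trans
            (sum_le_sum fun r hr => sum_le_sum fun s hs => hall r hr s hs)
      _ = _ := by
          congr 1
          simp only [sum_add_distrib, sum_const, card_range, nsmul_eq_mul]
          rw [sum_congr rfl (g := fun _ => (M : ℝ))]
          · simp; ring
          · intro r hr
            simp [mem_range.1 hr]
  rw [mul_pow] at h1
  have h2 : (M + H : ℝ) * (H * M + H ^ 2 * B) = H ^ 2 * ((M + H) * (M / H + B)) := by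
    field_simp
  rw [h2] at h1
  exact le_of_mul_le_mul_left h1 (by positivity)

/-- By telescoping, the differenced phase inherits bounds on the `(k + 1)`-th differences of `f`,
multiplied by `h`. This drives the induction on the order of the test. -/
lemma fwdDiff_iter_shift_sub (f : ℕ → ℝ) (h k n : ℕ) :
    (fwdDiff 1)^[k] (fun m => f (m + h) - f m) n =
      ∑ i ∈ range h, (fwdDiff 1)^[k + 1] f (n + i) := by
  have h1 : ∀ k n, (fwdDiff 1)^[k] (fun m => f (m + h) - f m) n =
      (fwdDiff 1)^[k] f (n + h) - (fwdDiff 1)^[k] f n := by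
    intro k
    induction k with
    | zero => intro n; simp
    | succ k ih =>
      intro n
      simp only [Function.iterate_succ_apply', fwdDiff]
      rw [ih, ih, add_right_comm n 1 h]
      ring
  rw [h1]
  simp only [Function.iterate_succ_apply', fwdDiff]
  have := sum_range_sub (fun i => (fwdDiff 1)^[k] f (n + i)) h
  simp only [add_zero, ← add_assoc] at this
  exact this.symm

/-- The trivial bound suffices whenever one of the two factors saves nothing; this disposes of
extreme values of `lam`. -/
lemma norm_sum_ePhase_le_one_le {M : ℕ} {N C x y : ℝ} (f : ℕ → ℝ) (hM : M ≤ N) (hx : 0 ≤ x)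
    (hy : 0 ≤ y) (h : 1 ≤ C * x ∨ 1 ≤ C * y) (hC : 0 ≤ C) :
    ‖∑ n ∈ range M, ePhase (f n)‖ ≤ C * N * (x + y) := by
  have h1 := norm_sum_ePhase_le_card (range M) f
  rw [card_range] at h1
  have hN : 0 ≤ N := (Nat.cast_nonneg M).trans hM
  have : 1 ≤ C * (x + y) := by
    have := mul_nonneg hC hx
    have := mul_nonneg hC hy
    rw [mul_add]
    rcases h with h | h <;> linarith
  nlinarith

set_option maxHeartbeats 1000000 in
/-- The `(j + 2)`-th difference test. -/
theorem exists_norm_sum_ePhase_le (j : ℕ) (A : ℝ) : ∃ C : ℝ, 1 ≤ C ∧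
    ∀ (N lam : ℝ) (M : ℕ) (f : ℕ → ℝ), 1 ≤ N → M ≤ N → 0 < lam →
      (∀ n < M, lam ≤ (fwdDiff 1)^[j + 2] f n ∧ (fwdDiff 1)^[j + 2] f n ≤ A * lam) →
      ‖∑ n ∈ range M, ePhase (f n)‖ ≤ C * N * (lam ^ ((1 / 3 : ℝ) * (1 / 4) ^ j) +
        (N ^ (3 / 2 : ℝ) * lam) ^ (-((1 / 3 : ℝ) * (1 / 4) ^ j))) := by
  induction j with
  | zero =>
    refine ⟨4 * |A| + 8, by have := abs_nonneg A; linarith, ?_⟩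
    intro N lam M f hN hM hlam hf
    have hA := abs_nonneg A
    have hN0 : 0 < N := by linarith
    rw [pow_zero, mul_one]
    by_cases hl : 1 / 8 < lam
    · refine norm_sum_ePhase_le_one_le f hM (by positivity) (by positivity) (Or.inl ?_)
        (by positivity)
      have : (1 / 8 : ℝ) ^ (1 / 3 : ℝ) ≤ lam ^ (1 / 3 : ℝ) := by gcongr
      rw [show (1 / 8 : ℝ) = (1 / 2) ^ (3 : ℝ) by norm_num, ← rpow_mul (by norm_num)] at this
      norm_num at this
      nlinarith
    push Not at hl
    by_cases hT : N ^ (3 / 2 : ℝ) * lam ≤ 1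
    · refine norm_sum_ePhase_le_one_le f hM (by positivity) (by positivity) (Or.inr ?_)
        (by positivity)
      have := one_le_rpow_of_pos_of_le_one_of_nonpos (by positivity) hT
        (show -(1 / 3 : ℝ) ≤ 0 by norm_num)
      nlinarith
    push Not at hT
    -- This choice balances `D / lam` against `1 / D ^ 2`. Both are then `lam ^ (-2/3)`, which is
    -- below `N` exactly when `N ^ (3/2) * lam > 1`; hence the exponent `3 / 2`.
    set D := lam ^ (1 / 3 : ℝ) with hD
    have hD0 : 0 < D := by positivity
    have hD3 : D ^ 3 = lam := by
      rw [hD, ← rpow_natCast, ← rpow_mul hlam.le]; norm_num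
    have hD2 : D ≤ 1 / 2 := by
      by_contra h
      push Not at h
      have : (1 / 2 : ℝ) ^ 3 < D ^ 3 := by gcongr
      rw [hD3] at this
      norm_num at this
      linarith
    have hexp : ∀ n, (fwdDiff 1)^[2] f n = (f (n + 2) - f (n + 1)) - (f (n + 1) - f n) := by
      intro n; simp [fwdDiff]
    have key := norm_sum_ePhase_second_diff (f := f) (M := M) (A := A) hlam hD0 hD2
      (fun n hn => (hexp n) ▸ (hf n hn).1) (fun n hn => (hexp n) ▸ (hf n hn).2)
    set T := (N ^ (3 / 2 : ℝ) * lam) ^ (-(1 / 3 : ℝ)) with hTdef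
    have hT0 : 0 < T := by positivity
    have hT1 : T ≤ 1 := rpow_le_one_of_one_le_of_nonpos hT.le (by norm_num)
    have hTD : N * T ^ 2 = 1 / D ^ 2 := by
      have : T = N ^ (-(1 / 2) : ℝ) * D⁻¹ := by
        rw [hTdef, mul_rpow (by positivity) hlam.le, ← rpow_mul hN0.le, hD, rpow_neg hlam.le]
        norm_num
      rw [this, mul_pow, ← rpow_natCast, ← rpow_mul hN0.le]
      norm_num
      rw [rpow_neg_one]
      field_simp
    refine key.trans ?_
    have hDl : D / lam = 1 / D ^ 2 := by rw [← hD3]; field_simp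
    rw [hDl]
    have hinv : 4 ≤ 1 / D ^ 2 := by
      rw [le_div_iff₀ (by positivity)]; nlinarith
    calc (A * lam * M + 2) * (2 * (1 / D ^ 2 + 1) + 1 / D ^ 2)
        ≤ (|A| * lam * N + 2) * (4 * (1 / D ^ 2)) := by
          have : A ≤ |A| := le_abs_self A
          gcongr
          linarith
      _ = 4 * |A| * N * D + 8 * (N * T ^ 2) := by
          rw [hTD, ← hD3]; field_simp; ring
      _ ≤ 4 * |A| * N * D + 8 * (N * T) := by
          have : T ^ 2 ≤ T := by nlinarith
          gcongr
      _ ≤ _ := by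
          have : 0 ≤ |A| * N * T := by positivity
          have : 0 ≤ N * D := by positivity
          nlinarith
  | succ j ih =>
    obtain ⟨C, hC1, hC⟩ := ih
    refine ⟨3 * (1 + 2 * C), by linarith, ?_⟩
    intro N lam M f hN hM hlam hf
    have hN0 : 0 < N := by linarith
    set a : ℝ := (1 / 3 : ℝ) * (1 / 4) ^ j with ha
    have ha0 : 0 < a := by positivity
    have ha1 : a ≤ 1 := by
      have : (1 / 4 : ℝ) ^ j ≤ 1 := pow_le_one₀ (by norm_num) (by norm_num)
      linarith
    have ha' : (1 / 3 : ℝ) * (1 / 4) ^ (j + 1) = a / 4 := by rw [ha, pow_succ]; ring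
    rw [ha']
    by_cases hl : 1 ≤ lam
    · refine norm_sum_ePhase_le_one_le f hM (by positivity) (by positivity) (Or.inl ?_)
        (by positivity)
      have := one_le_rpow hl (show 0 ≤ a / 4 by positivity)
      nlinarith
    push Not at hl
    by_cases hT : N ^ (3 / 2 : ℝ) * lam ≤ 1
    · refine norm_sum_ePhase_le_one_le f hM (by positivity) (by positivity) (Or.inr ?_)
        (by positivity)
      have := one_le_rpow_of_pos_of_le_one_of_nonpos (by positivity) hT
        (show -(a / 4) ≤ 0 by linarith)
      nlinarith
    push Not at hT
    set W := N ^ (3 / 2 : ℝ) * lam with hW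
    have hW0 : 0 < W := by linarith
    -- With about `lam ^ (-1/2)` shifts, the differenced phases have `(j + 2)`-th differences at
    -- most of order `lam ^ (1/2)`. This halves the exponent, and the square in van der Corput's
    -- inequality halves it again: hence `a / 4`.
    set R := lam ^ (-(1 / 2) : ℝ) with hR
    have hR0 : 0 < R := by positivity
    have hR1 : 1 ≤ R := one_le_rpow_of_pos_of_le_one_of_nonpos hlam hl.le (by norm_num)
    -- Follows from `lam > N ^ (-3/2) ≥ N ^ (-2)`; it keeps `M + H` below `3 * N`.
    have hRN : R ≤ N := by
      have h1 : lam⁻¹ ≤ N ^ (2 : ℝ) := by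
        rw [inv_le_iff_one_le_mul₀ hlam]
        refine hT.le.trans ?_
        rw [hW]
        gcongr
        · norm_num
      have h2 : (lam⁻¹) ^ (1 / 2 : ℝ) ≤ (N ^ (2 : ℝ)) ^ (1 / 2 : ℝ) := by gcongr
      rw [← rpow_mul hN0.le, inv_rpow hlam.le, ← rpow_neg hlam.le] at h2
      norm_num at h2
      rw [hR]
      norm_num
      exact h2
    set H := ⌈R⌉₊ with hHdef
    have hHR : R ≤ H := Nat.le_ceil _
    have hH2 : (H : ℝ) ≤ 2 * R := by
      have := Nat.ceil_lt_add_one hR0.le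
      linarith
    have hH : 0 < H := Nat.ceil_pos.2 hR0
    have hRl : R * lam = lam ^ (1 / 2 : ℝ) := by
      rw [hR, ← rpow_add_one hlam.ne']; norm_num
    set B := C * N * (2 * lam ^ (a / 2) + W ^ (-a)) with hB
    have hcor : ∀ h, 1 ≤ h → h < H → ‖∑ n ∈ range (M - h), ePhase (f (n + h)) *
        (starRingEnd ℂ) (ePhase (f n))‖ ≤ B := by
      intro h h1 h2
      simp only [← ePhase_sub]
      have hh : (1 : ℝ) ≤ h := by exact_mod_cast h1
      have hhH : (h : ℝ) ≤ H := by exact_mod_cast h2.le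
      refine (hC N (h * lam) (M - h) (fun n => f (n + h) - f n) hN ?_ (by positivity) ?_).trans ?_
      · refine le_trans ?_ hM
        exact_mod_cast Nat.sub_le _ _
      · intro n hn
        rw [fwdDiff_iter_shift_sub]
        constructor
        · have := card_nsmul_le_sum (range h) (fun i => (fwdDiff 1)^[j + 2 + 1] f (n + i)) lam
            (fun i hi => (hf (n + i) (by have := mem_range.1 hi; omega)).1)
          rwa [card_range, nsmul_eq_mul] at this
        · have := sum_le_card_nsmul (range h) (fun i => (fwdDiff 1)^[j + 2 + 1] f (n + i)) (A * lam)
            (fun i hi => (hf (n + i) (by have := mem_range.1 hi; omega)).2)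
          rw [card_range, nsmul_eq_mul] at this
          linarith
      · rw [hB]
        gcongr ?_ * (?_ + ?_)
        · calc (h * lam) ^ a ≤ (2 * lam ^ (1 / 2 : ℝ)) ^ a := by
                refine rpow_le_rpow (by positivity) ?_ ha0.le
                rw [← hRl]
                nlinarith
            _ = 2 ^ a * lam ^ (a / 2) := by
                rw [mul_rpow (by norm_num) (by positivity), ← rpow_mul hlam.le]
                ring_nf
            _ ≤ 2 * lam ^ (a / 2) := by
                gcongr
                calc (2 : ℝ) ^ a ≤ 2 ^ (1 : ℝ) := by gcongr; norm_num
                  _ = 2 := by norm_num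
        · apply rpow_le_rpow_of_nonpos hW0 _ (by linarith)
          rw [hW]
          have : 0 ≤ N ^ (3 / 2 : ℝ) * lam := by positivity
          nlinarith
    have key := vanDerCorput (z := fun n => ePhase (f n)) (M := M) hH (fun n => (norm_ePhase _).le)
      (by positivity) hcor
    set p := lam ^ (a / 4) with hp
    set q := W ^ (-(a / 4)) with hq
    have hp0 : 0 < p := by positivity
    have hq0 : 0 < q := by positivity
    have hp2 : lam ^ (a / 2) = p ^ 2 := by
      rw [hp, ← rpow_natCast, ← rpow_mul hlam.le]; congr 1; push_cast; ring
    have hq2 : W ^ (-a) ≤ q ^ 2 := by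
      rw [hq, ← rpow_natCast, ← rpow_mul hW0.le]
      apply rpow_le_rpow_of_exponent_le hT.le
      push_cast; linarith
    have hMH : (M : ℝ) / H ≤ N * p ^ 2 := by
      rw [← hp2]
      have h1 : (M : ℝ) / H ≤ N / R := by gcongr
      have h2 : N / R = N * lam ^ (1 / 2 : ℝ) := by
        rw [hR, rpow_neg hlam.le, div_inv_eq_mul]
      have h3 : lam ^ (1 / 2 : ℝ) ≤ lam ^ (a / 2) :=
        rpow_le_rpow_of_exponent_ge hlam hl.le (by linarith)
      rw [h2] at h1
      exact h1.trans (by gcongr)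
    refine (sq_le_sq₀ (norm_nonneg _) (by positivity)).1 (key.trans ?_)
    calc ((M : ℝ) + H) * (M / H + B) ≤ (3 * N) * (N * p ^ 2 + C * N * (2 * p ^ 2 + q ^ 2)) := by
          rw [hB, hp2]
          gcongr
          linarith
      _ ≤ 3 * (1 + 2 * C) * (N * (p + q)) ^ 2 := by
          have e1 : (N * (p + q)) ^ 2 = N ^ 2 * (p ^ 2 + 2 * p * q + q ^ 2) := by ring
          have e2 : 3 * N * (N * p ^ 2 + C * N * (2 * p ^ 2 + q ^ 2)) =
            N ^ 2 * (3 * p ^ 2 + 6 * C * p ^ 2 + 3 * C * q ^ 2) := by ring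
          rw [e1, e2, mul_left_comm]
          gcongr
          have : 0 ≤ p * q := by positivity
          have hC0 : 0 ≤ C := by linarith
          linarith [sq_nonneg q, mul_nonneg hC0 this, mul_nonneg hC0 (sq_nonneg q)]
      _ ≤ (3 * (1 + 2 * C)) ^ 2 * (N * (p + q)) ^ 2 := by
          refine mul_le_mul_of_nonneg_right ?_ (sq_nonneg _)
          nlinarith
      _ = _ := by ring

/-! ### Exponential sums with phase `β n^c` -/

lemma hasDerivAt_fwdDiff_iter_rpow (k : ℕ) (c : ℝ) {x : ℝ} (hx : 0 < x) :
    HasDerivAt ((fwdDiff 1)^[k] (fun t : ℝ => t ^ c))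
      (c * (fwdDiff 1)^[k] (fun t : ℝ => t ^ (c - 1)) x) x := by
  induction k generalizing x with
  | zero => simpa using hasDerivAt_rpow_const (Or.inl hx.ne')
  | succ k ih =>
    simp only [Function.iterate_succ_apply']
    have h1 := (ih (x := x + 1) (by linarith)).comp_add_const x 1
    have h2 := h1.sub (ih hx)
    simp only [fwdDiff]
    rw [mul_sub]
    exact h2

/-- One use of the mean value theorem trades a difference for a derivative, that is, for a factor
`c` and the exponent `c - 1`; then induct. -/
lemma exists_fwdDiff_iter_rpow (k : ℕ) (c : ℝ) {x : ℝ} (hx : 0 < x) :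
    ∃ ξ : ℝ, x ≤ ξ ∧ ξ ≤ x + k ∧ (fwdDiff 1)^[k] (fun t : ℝ => t ^ c) x =
      (∏ i ∈ range k, (c - i)) * ξ ^ (c - k) := by
  induction k generalizing c x with
  | zero => exact ⟨x, le_rfl, by simp, by simp⟩
  | succ k ih =>
    obtain ⟨y, hy, hy'⟩ := exists_hasDerivAt_eq_slope ((fwdDiff 1)^[k] (fun t : ℝ => t ^ c))
      (fun y => c * (fwdDiff 1)^[k] (fun t : ℝ => t ^ (c - 1)) y) (show x < x + 1 by linarith)
      (fun y hy => (hasDerivAt_fwdDiff_iter_rpow k c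
        (hx.trans_le hy.1)).continuousAt.continuousWithinAt)
      (fun y hy => hasDerivAt_fwdDiff_iter_rpow k c (hx.trans hy.1))
    obtain ⟨ξ, h1, h2, h3⟩ := ih (c - 1) (hx.trans hy.1)
    refine ⟨ξ, hy.1.le.trans h1, ?_, ?_⟩
    · push_cast
      linarith [hy.2]
    · rw [Function.iterate_succ_apply', fwdDiff]
      rw [add_sub_cancel_left, div_one] at hy'
      rw [← hy', h3, prod_range_succ']
      have : ∀ i ∈ range k, c - 1 - (i : ℝ) = c - ((i + 1 : ℕ) : ℝ) := fun i _ => by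
        push_cast; ring
      rw [prod_congr rfl this]
      push_cast
      rw [show c - 1 - (k : ℝ) = c - (k + 1) by ring]
      ring

lemma fwdDiff_iter_nat_cast (g : ℝ → ℝ) (x : ℝ) (k n : ℕ) :
    (fwdDiff 1)^[k] (fun m : ℕ => g (x + m)) n = (fwdDiff 1)^[k] g (x + n) := by
  induction k generalizing n with
  | zero => simp
  | succ k ih =>
    simp only [Function.iterate_succ_apply', fwdDiff]
    rw [ih, ih]
    push_cast
    rw [add_assoc]

lemma norm_sum_ePhase_neg {ι : Type*} (s : Finset ι) (f : ι → ℝ) :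
    ‖∑ n ∈ s, ePhase (-f n)‖ = ‖∑ n ∈ s, ePhase (f n)‖ := by
  simp only [ePhase_neg]
  rw [← map_sum, RCLike.norm_conj]

lemma rpow_le_rpow_abs {t K s : ℝ} (h1 : 1 ≤ t) (h2 : t ≤ K) : t ^ s ≤ K ^ |s| :=
  (rpow_le_rpow_of_exponent_le h1 (le_abs_self s)).trans
    (rpow_le_rpow (by linarith) h2 (abs_nonneg s))

/-- A block of `e (β n ^ c)`, when `|β| Y ^ c` is close to a power of `Y`. -/
lemma exists_norm_sum_rpow_block_aux {c : ℝ} (hcZ : ∀ k : ℤ, c ≠ k) (j : ℕ) :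
    ∃ η : ℝ, 0 < η ∧ η ≤ 1 / 2 ∧ ∃ C : ℝ, 0 ≤ C ∧ ∀ (Y M : ℕ) (β : ℝ), 1 ≤ Y → M ≤ 2 * Y →
      (Y : ℝ) ^ (j + 3 / 4 : ℝ) ≤ |β| * (Y : ℝ) ^ c →
      |β| * (Y : ℝ) ^ c ≤ (Y : ℝ) ^ (j + 7 / 4 : ℝ) →
      ‖∑ n ∈ range M, ePhase (β * (Y + 1 + n : ℝ) ^ c)‖ ≤ C * (Y : ℝ) ^ (1 - η) := by
  set k := j + 2 with hk
  set P := ∏ i ∈ range k, (c - i) with hP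
  -- The only place where it matters that `c` is not an integer.
  have hP0 : P ≠ 0 := prod_ne_zero_iff.2 fun i _ h => hcZ i (by push_cast; linarith)
  have hPabs : 0 < |P| := abs_pos.2 hP0
  set T : ℝ := ((k : ℝ) + 4) ^ |c - k| with hT
  have hT1 : 1 ≤ T := one_le_rpow (by linarith [(Nat.cast_nonneg k : (0 : ℝ) ≤ k)]) (abs_nonneg _)
  have hT0 : 0 < T := by linarith
  obtain ⟨C, hC1, hC⟩ := exists_norm_sum_ePhase_le j (T ^ 2)
  set a : ℝ := (1 / 3 : ℝ) * (1 / 4) ^ j with ha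
  have ha0 : 0 < a := by positivity
  have ha1 : a ≤ 1 := by
    have : (1 / 4 : ℝ) ^ j ≤ 1 := pow_le_one₀ (by norm_num) (by norm_num)
    linarith
  set Q := |P| / T with hQ
  have hQ0 : 0 < Q := by positivity
  -- Here `lam` is at most a constant times `Y ^ (-1/4)`, while `Y ^ (3/2) * lam` is at least a
  -- constant times `Y ^ (1/4)`. Raised to the powers `a` and `-a`, both give `Y ^ (-a/4)`.
  refine ⟨a / 4, by positivity, by linarith, C * 2 * (Q ^ a + Q ^ (-a)), by positivity, ?_⟩
  have main : ∀ (Y M : ℕ) (β : ℝ), 1 ≤ Y → M ≤ 2 * Y → 0 < β * P →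
      (Y : ℝ) ^ (j + 3 / 4 : ℝ) ≤ |β| * (Y : ℝ) ^ c →
      |β| * (Y : ℝ) ^ c ≤ (Y : ℝ) ^ (j + 7 / 4 : ℝ) →
      ‖∑ n ∈ range M, ePhase (β * (Y + 1 + n : ℝ) ^ c)‖ ≤
        C * 2 * (Q ^ a + Q ^ (-a)) * (Y : ℝ) ^ (1 - a / 4) := by
    intro Y M β hY hM hs h1 h2
    have hY1 : (1 : ℝ) ≤ Y := by exact_mod_cast hY
    have hY0 : (0 : ℝ) < Y := by linarith
    have hM' : (M : ℝ) ≤ 2 * Y := by exact_mod_cast hM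
    set lam := |β| * (Y : ℝ) ^ c * (Y : ℝ) ^ (-(k : ℝ)) * Q with hlam
    have hβ : 0 < |β| := abs_pos.2 (left_ne_zero_of_mul hs.ne')
    have hlam0 : 0 < lam := by positivity
    have hbp : β * P = |β| * |P| := by rw [← abs_mul, abs_of_pos hs]
    have hdiff : ∀ n < M, lam ≤ (fwdDiff 1)^[j + 2] (fun n : ℕ => β * (Y + 1 + n : ℝ) ^ c) n ∧
        (fwdDiff 1)^[j + 2] (fun n : ℕ => β * (Y + 1 + n : ℝ) ^ c) n ≤ T ^ 2 * lam := by
      intro n hn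
      have e1 := fwdDiff_iter_const_smul (h := 1) β (fun n : ℕ => ((Y : ℝ) + 1 + n) ^ c) (j + 2)
      have e2 : (fwdDiff 1)^[j + 2] (fun n : ℕ => β * (Y + 1 + n : ℝ) ^ c) n =
          β * (fwdDiff 1)^[j + 2] (fun t : ℝ => t ^ c) (Y + 1 + n) := by
        rw [← fwdDiff_iter_nat_cast]
        exact congrFun e1 n
      obtain ⟨ξ, x1, x2, x3⟩ := exists_fwdDiff_iter_rpow k c (x := (Y : ℝ) + 1 + n) (by positivity)
      rw [e2, x3, ← mul_assoc, hbp]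
      have hn' : (n : ℝ) ≤ 2 * Y := by
        have : (n : ℝ) ≤ M := by exact_mod_cast hn.le
        linarith
      set t := ξ / Y with ht
      have hξ : ξ = Y * t := by rw [ht]; field_simp
      have ht1 : 1 ≤ t := by
        rw [ht, le_div_iff₀ hY0]
        have := (Nat.cast_nonneg n : (0 : ℝ) ≤ n)
        linarith
      have ht2 : t ≤ k + 4 := by
        rw [ht, div_le_iff₀ hY0]
        have : (0 : ℝ) ≤ k := Nat.cast_nonneg k
        nlinarith
      have ht0 : 0 < t := by linarith
      have u1 : t ^ (c - k) ≤ T := rpow_le_rpow_abs ht1 ht2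
      have u2 : T⁻¹ ≤ t ^ (c - k) := by
        have := rpow_le_rpow_abs (s := -(c - k)) ht1 ht2
        rw [abs_neg, rpow_neg ht0.le] at this
        exact inv_le_of_inv_le₀ (by positivity) this
      have e3 : |β| * |P| * ξ ^ (c - k) = lam * T * t ^ (c - k) := by
        rw [hξ, mul_rpow hY0.le ht0.le, hlam, hQ, sub_eq_add_neg, rpow_add hY0, mul_assoc,
          mul_assoc]
        field_simp
      rw [e3]
      constructor
      · calc lam = lam * T * T⁻¹ := by field_simp
          _ ≤ _ := by gcongr
      · calc lam * T * t ^ (c - k) ≤ lam * T * T := by gcongr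
          _ = _ := by ring
    refine (hC (2 * Y) lam M _ (by linarith) hM' hlam0 hdiff).trans ?_
    have v1 : lam ≤ (Y : ℝ) ^ (-(1 / 4) : ℝ) * Q := by
      rw [hlam]
      gcongr
      calc |β| * (Y : ℝ) ^ c * (Y : ℝ) ^ (-(k : ℝ)) ≤
          (Y : ℝ) ^ (j + 7 / 4 : ℝ) * (Y : ℝ) ^ (-(k : ℝ)) := by gcongr
        _ = _ := by
          rw [← rpow_add hY0, hk]; congr 1; push_cast; ring
    have v2 : (Y : ℝ) ^ (1 / 4 : ℝ) * Q ≤ (2 * Y) ^ (3 / 2 : ℝ) * lam := by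
      rw [hlam, ← mul_assoc]
      gcongr
      calc (Y : ℝ) ^ (1 / 4 : ℝ) = (Y : ℝ) ^ (3 / 2 : ℝ) *
            ((Y : ℝ) ^ (j + 3 / 4 : ℝ) * (Y : ℝ) ^ (-(k : ℝ))) := by
            rw [← rpow_add hY0, ← rpow_add hY0, hk]; congr 1; push_cast; ring
        _ ≤ _ := by
          gcongr
          linarith
    have w1 : lam ^ a ≤ Q ^ a * (Y : ℝ) ^ (-(a / 4)) := by
      calc lam ^ a ≤ ((Y : ℝ) ^ (-(1 / 4) : ℝ) * Q) ^ a := by gcongr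
        _ = _ := by
          rw [mul_rpow (by positivity) hQ0.le, ← rpow_mul hY0.le, mul_comm]
          congr 2; ring
    have w2 : ((2 * Y) ^ (3 / 2 : ℝ) * lam) ^ (-a) ≤ Q ^ (-a) * (Y : ℝ) ^ (-(a / 4)) := by
      calc ((2 * Y) ^ (3 / 2 : ℝ) * lam) ^ (-a) ≤ ((Y : ℝ) ^ (1 / 4 : ℝ) * Q) ^ (-a) :=
            rpow_le_rpow_of_nonpos (by positivity) v2 (by linarith)
        _ = _ := by
          rw [mul_rpow (by positivity) hQ0.le, ← rpow_mul hY0.le, mul_comm]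
          congr 2; ring
    calc _ ≤ C * (2 * Y) * (Q ^ a * (Y : ℝ) ^ (-(a / 4)) + Q ^ (-a) * (Y : ℝ) ^ (-(a / 4))) := by
          gcongr
      _ = _ := by
          rw [sub_eq_add_neg, rpow_add hY0, rpow_one]; ring
  intro Y M β hY hM h1 h2
  have hY0 : (0 : ℝ) < Y := by exact_mod_cast hY
  have hβ : β ≠ 0 := by
    rintro rfl
    have : (0 : ℝ) < (Y : ℝ) ^ (j + 3 / 4 : ℝ) := by positivity
    simp at h1
    linarith
  -- The difference test wants positive differences; conjugating the sum flips the sign of `β`.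
  rcases lt_or_gt_of_ne (mul_ne_zero hβ hP0) with h | h
  · rw [← norm_sum_ePhase_neg]
    simp only [← neg_mul]
    exact main Y M (-β) hY hM (by linarith) (by rwa [abs_neg]) (by rwa [abs_neg])
  · exact main Y M β hY hM h h1 h2

/-- The windows `[j + 3/4, j + 7/4]` abut, so finitely many orders of differencing cover any bounded
range of exponents. -/
lemma exists_norm_sum_rpow_block {c : ℝ} (hcZ : ∀ k : ℤ, c ≠ k) (j : ℕ) :
    ∃ η : ℝ, 0 < η ∧ η ≤ 1 / 2 ∧ ∃ C : ℝ, 0 ≤ C ∧ ∀ (Y M : ℕ) (β : ℝ), 1 ≤ Y → M ≤ 2 * Y →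
      (Y : ℝ) ^ (3 / 4 : ℝ) ≤ |β| * (Y : ℝ) ^ c →
      |β| * (Y : ℝ) ^ c ≤ (Y : ℝ) ^ (j + 7 / 4 : ℝ) →
      ‖∑ n ∈ range M, ePhase (β * (Y + 1 + n : ℝ) ^ c)‖ ≤ C * (Y : ℝ) ^ (1 - η) := by
  induction j with
  | zero => simpa using exists_norm_sum_rpow_block_aux hcZ 0
  | succ j ih =>
    obtain ⟨η, h0, h1, C, hC0, hC⟩ := ih
    obtain ⟨η', h0', h1', C', hC0', hC'⟩ := exists_norm_sum_rpow_block_aux hcZ (j + 1)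
    refine ⟨min η η', lt_min h0 h0', (min_le_left _ _).trans h1, max C C',
      hC0.trans (le_max_left _ _), ?_⟩
    intro Y M β hY hM h1 h2
    have hY1 : (1 : ℝ) ≤ Y := by exact_mod_cast hY
    rcases le_total (|β| * (Y : ℝ) ^ c) ((Y : ℝ) ^ (j + 7 / 4 : ℝ)) with h | h
    · refine (hC Y M β hY hM h1 h).trans ?_
      gcongr
      · exact le_max_left _ _
      · exact min_le_left _ _
    · refine (hC' Y M β hY hM ?_ h2).trans ?_
      · rw [show ((j + 1 : ℕ) : ℝ) + 3 / 4 = j + 7 / 4 by push_cast; ring]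
        exact h
      · gcongr
        · exact le_max_right _ _
        · exact min_le_right _ _

/-- Power saving for `∑ e (β n ^ c)`, for `β` between two powers of the length. -/
theorem exists_norm_sum_rpow_le {c : ℝ} (hc : 1 < c) (hcZ : ∀ k : ℤ, c ≠ k) (B : ℝ) :
    ∃ η : ℝ, 0 < η ∧ η ≤ 1 / 2 ∧ ∃ C : ℝ, 0 ≤ C ∧ ∀ (X β : ℝ) (Y : ℕ), 1 ≤ X → Y ≤ X →
      X ^ (-((c - 1) / 2)) ≤ |β| → |β| ≤ X ^ B →
      ‖∑ n ∈ Ioc 0 Y, ePhase (β * (n : ℝ) ^ c)‖ ≤ C * X ^ (1 - η) := by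
  obtain ⟨j, hj⟩ := exists_nat_ge (2 * |B| + c)
  obtain ⟨η, h0, h1, C, hC0, hC⟩ := exists_norm_sum_rpow_block hcZ j
  refine ⟨η, h0, h1, 3 + 3 * C, by positivity, ?_⟩
  intro X β Y hX hYX hβ1 hβ2
  have hX0 : 0 < X := by linarith
  have hind : ∀ Y : ℕ, Y ≤ X → ‖∑ n ∈ Ioc 0 Y, ePhase (β * (n : ℝ) ^ c)‖ ≤
      3 * X ^ (1 / 2 : ℝ) + 3 * C * (Y : ℝ) ^ (1 - η) := by
    intro Y
    induction Y using Nat.strong_induction_on with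
    | _ Y ih =>
      intro hYX
      -- Halving: `(Z, Y]` is one block and `(0, Z]` is treated by induction, down to `Z < X ^
      -- (1/2)`, where counting is enough. Above that, `X ≤ Z ^ 2` converts bounds on `|β|` in terms
      -- of `X` into powers of `Z`.
      set Z := Y / 2 with hZ
      have hX2 : 1 ≤ X ^ (1 / 2 : ℝ) := one_le_rpow hX (by norm_num)
      by_cases hsm : (Z : ℝ) < X ^ (1 / 2 : ℝ)
      · have t1 := norm_sum_ePhase_le_card (Ioc 0 Y) (fun n => β * (n : ℝ) ^ c)
        rw [Nat.card_Ioc, Nat.sub_zero] at t1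
        have t2 : (Y : ℝ) ≤ 2 * Z + 1 := by
          have : Y ≤ 2 * Z + 1 := by omega
          exact_mod_cast this
        have : 0 ≤ 3 * C * (Y : ℝ) ^ (1 - η) := by positivity
        linarith
      push Not at hsm
      have hZ1 : 1 ≤ Z := by
        have : (1 : ℝ) ≤ Z := hX2.trans hsm
        exact_mod_cast this
      have hZ0 : (0 : ℝ) < Z := by exact_mod_cast hZ1
      have hZ1' : (1 : ℝ) ≤ Z := by exact_mod_cast hZ1
      have hZY : (2 : ℝ) * Z ≤ Y := by
        have : 2 * Z ≤ Y := by omega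
        exact_mod_cast this
      have hXZ : X ≤ (Z : ℝ) ^ (2 : ℝ) := by
        calc X = (X ^ (1 / 2 : ℝ)) ^ (2 : ℝ) := by rw [← rpow_mul hX0.le]; norm_num
          _ ≤ _ := by gcongr
      have hZi := ih Z (by omega) (by linarith)
      have hsplit : ∑ n ∈ Ioc 0 Y, ePhase (β * (n : ℝ) ^ c) =
          ∑ n ∈ Ioc 0 Z, ePhase (β * (n : ℝ) ^ c) +
            ∑ n ∈ range (Y - Z), ePhase (β * (Z + 1 + n : ℝ) ^ c) := by
        rw [← sum_Ioc_consecutive _ (Nat.zero_le Z) (show Z ≤ Y by omega)]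
        congr 1
        have : Ioc Z Y = Ico (Z + 1) (Y + 1) := by ext n; rw [mem_Ioc, mem_Ico]; omega
        rw [this, sum_Ico_eq_sum_range, show Y + 1 - (Z + 1) = Y - Z by omega]
        push_cast
        rfl
      have hblock := hC Z (Y - Z) β hZ1 (by omega) ?_ ?_
      · rw [hsplit]
        refine (norm_add_le _ _).trans ((add_le_add hZi hblock).trans ?_)
        -- Since `η ≤ 1/2`, doubling the length gains a factor of at least `√2`. The induction
        -- closes because `3 * C + C ≤ 3 * C * 1.4`.
        have hY' : (1.4 : ℝ) * (Z : ℝ) ^ (1 - η) ≤ (Y : ℝ) ^ (1 - η) := by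
          calc (1.4 : ℝ) * (Z : ℝ) ^ (1 - η) ≤ 2 ^ (1 - η) * (Z : ℝ) ^ (1 - η) := by
                gcongr
                calc (1.4 : ℝ) ≤ √2 := le_sqrt_of_sq_le (by norm_num)
                  _ = 2 ^ (1 / 2 : ℝ) := sqrt_eq_rpow 2
                  _ ≤ 2 ^ (1 - η) := rpow_le_rpow_of_exponent_le (by norm_num) (by linarith)
            _ = (2 * Z : ℝ) ^ (1 - η) := (mul_rpow zero_le_two hZ0.le).symm
            _ ≤ _ := by
                gcongr
                linarith
        have : 0 ≤ C * (Z : ℝ) ^ (1 - η) := by positivity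
        have := mul_le_mul_of_nonneg_left hY' hC0
        linarith
      · calc (Z : ℝ) ^ (3 / 4 : ℝ) ≤ (Z : ℝ) ^ (1 : ℝ) :=
              rpow_le_rpow_of_exponent_le hZ1' (by norm_num)
          _ = ((Z : ℝ) ^ (2 : ℝ)) ^ (-((c - 1) / 2)) * (Z : ℝ) ^ c := by
              rw [← rpow_mul hZ0.le, ← rpow_add hZ0]; congr 1; ring
          _ ≤ X ^ (-((c - 1) / 2)) * (Z : ℝ) ^ c := by
              refine mul_le_mul_of_nonneg_right ?_ (by positivity)
              exact rpow_le_rpow_of_nonpos hX0 hXZ (by linarith)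
          _ ≤ _ := by gcongr
      · calc |β| * (Z : ℝ) ^ c ≤ X ^ |B| * (Z : ℝ) ^ c := by
              gcongr
              exact hβ2.trans (rpow_le_rpow_of_exponent_le hX (le_abs_self B))
          _ ≤ ((Z : ℝ) ^ (2 : ℝ)) ^ |B| * (Z : ℝ) ^ c := by gcongr
          _ = (Z : ℝ) ^ (2 * |B| + c) := by rw [← rpow_mul hZ0.le, ← rpow_add hZ0]
          _ ≤ _ := rpow_le_rpow_of_exponent_le hZ1' (by linarith)
  refine (hind Y hYX).trans ?_
  have e1 : X ^ (1 / 2 : ℝ) ≤ X ^ (1 - η) := rpow_le_rpow_of_exponent_le hX (by linarith)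
  have e2 : (Y : ℝ) ^ (1 - η) ≤ X ^ (1 - η) := by
    apply rpow_le_rpow (Nat.cast_nonneg _) hYX (by linarith)
  have := mul_le_mul_of_nonneg_left e2 hC0
  linarith

/-! ### Vaughan's identity and sums over divisors -/

/-- The restriction of an arithmetic function to `n ≤ V`. -/
def lowPart (V : ℕ) (f : ArithmeticFunction ℝ) : ArithmeticFunction ℝ :=
  ⟨fun n => if n ≤ V then f n else 0, by simp⟩

lemma lowPart_apply (V : ℕ) (f : ArithmeticFunction ℝ) (n : ℕ) :
    lowPart V f n = if n ≤ V then f n else 0 := rfl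

/-- Vaughan's identity. -/
lemma vaughan (V : ℕ) : Λ = lowPart V Λ + lowPart V (μ : ArithmeticFunction ℝ) * ArithmeticFunction.log -
    (lowPart V (μ : ArithmeticFunction ℝ) * lowPart V Λ) * (ζ : ArithmeticFunction ℝ) +
    (((μ : ArithmeticFunction ℝ) - lowPart V (μ : ArithmeticFunction ℝ)) *
      (ζ : ArithmeticFunction ℝ)) * (Λ - lowPart V Λ) := by
  have h1 : (μ : ArithmeticFunction ℝ) * (ζ : ArithmeticFunction ℝ) = 1 :=
    ArithmeticFunction.coe_moebius_mul_coe_zeta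
  have h2 : Λ * (ζ : ArithmeticFunction ℝ) = ArithmeticFunction.log := ArithmeticFunction.vonMangoldt_mul_zeta
  rw [← h2]
  linear_combination (lowPart V Λ - Λ) * h1

lemma sum_Ioc_conv_mul (f g : ArithmeticFunction ℝ) (z : ℕ → ℂ) (N : ℕ) :
    ∑ n ∈ Ioc 0 N, ((f * g) n : ℂ) * z n =
      ∑ k ∈ Ioc 0 N, (f k : ℂ) * ∑ l ∈ Ioc 0 (N / k), (g l : ℂ) * z (k * l) := by
  have h1 : ∑ n ∈ Ioc 0 N, ((f * g) n : ℂ) * z n =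
      ∑ x ∈ Ioc 0 N ×ˢ Ioc 0 N with x.1 * x.2 ≤ N, (f x.1 : ℂ) * (g x.2) * z (x.1 * x.2) := by
    trans ∑ n ∈ Ioc 0 N, ∑ x ∈ Ioc 0 N ×ˢ Ioc 0 N with x.1 * x.2 = n,
      (f x.1 : ℂ) * (g x.2) * z (x.1 * x.2)
    · refine sum_congr rfl fun n hn ↦ ?_
      simp only [mem_Ioc] at hn
      rw [ArithmeticFunction.mul_apply, Nat.divisorsAntidiagonal_eq_prod_filter_of_le hn.1.ne' hn.2]
      push_cast
      rw [sum_mul]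
      refine sum_congr rfl fun x hx => ?_
      rw [(mem_filter.1 hx).2]
    · simp_rw [sum_filter]
      rw [sum_comm]
      exact sum_congr rfl fun _ _ ↦ (by simp_all)
  rw [h1, sum_filter, sum_product]
  refine sum_congr rfl fun k hk ↦ ?_
  have hk := mem_Ioc.1 hk
  rw [← sum_filter, mul_sum]
  refine sum_congr ?_ fun l _ => by ring
  ext l
  simp only [mem_filter, mem_Ioc, Nat.le_div_iff_mul_le hk.1]
  constructor
  · rintro ⟨⟨h1, h2⟩, h3⟩
    exact ⟨h1, by rwa [mul_comm]⟩
  · rintro ⟨h1, h2⟩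
    refine ⟨⟨h1, ?_⟩, by rwa [mul_comm]⟩
    exact (Nat.le_mul_of_pos_right l hk.1).trans h2

lemma sum_inv_Ioc_le {K N : ℕ} (h : K ≤ N) :
    ∑ k ∈ Ioc 0 K, (k : ℝ)⁻¹ ≤ 1 + Real.log N := by
  rcases K.eq_zero_or_pos with rfl | hK
  · simp
    positivity
  have h1 := harmonic_le_one_add_log K
  rw [harmonic_eq_sum_Icc] at h1
  push_cast at h1
  have h2 : Real.log K ≤ Real.log N := by
    apply Real.log_le_log
    · exact_mod_cast hK
    · exact_mod_cast h
  have : Ioc 0 K = Icc 1 K := by ext n; rw [mem_Ioc, mem_Icc]; omega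
  rw [this]
  linarith

lemma sum_card_divisors_le {K N : ℕ} (h : K ≤ N) :
    ∑ k ∈ Ioc 0 K, (k.divisors.card : ℝ) ≤ K * (1 + Real.log N) := by
  have h1 := ArithmeticFunction.sum_Ioc_sigma0_eq_sum_div K
  simp only [ArithmeticFunction.sigma_zero_apply] at h1
  have h2 : ∑ k ∈ Ioc 0 K, (k.divisors.card : ℝ) = ∑ k ∈ Ioc 0 K, ((K / k : ℕ) : ℝ) := by
    exact_mod_cast h1
  rw [h2]
  calc _ ≤ ∑ k ∈ Ioc 0 K, (K : ℝ) * (k : ℝ)⁻¹ := by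
        refine sum_le_sum fun k _ => ?_
        rw [← div_eq_mul_inv]
        exact Nat.cast_div_le
    _ ≤ _ := by
        rw [← mul_sum]
        gcongr
        exact sum_inv_Ioc_le h

/-- Of `d` and `k / d`, one is at most `√k`. -/
lemma card_divisors_le_two_mul_sqrt (k : ℕ) : (k.divisors.card : ℝ) ≤ 2 * √k := by
  have h : k.divisors ⊆ Icc 1 k.sqrt ∪ (Icc 1 k.sqrt).image (fun d => k / d) := by
    intro d hd
    have hdk := Nat.dvd_of_mem_divisors hd
    have hk := (Nat.mem_divisors.1 hd).2
    have hd0 := Nat.pos_of_mem_divisors hd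
    rw [mem_union, mem_image]
    by_cases hs : d ≤ k.sqrt
    · exact Or.inl (mem_Icc.2 ⟨hd0, hs⟩)
    · right
      refine ⟨k / d, mem_Icc.2 ⟨Nat.div_pos (Nat.le_of_dvd (Nat.pos_of_ne_zero hk) hdk) hd0, ?_⟩,
        Nat.div_div_self hdk hk⟩
      by_contra h2
      push Not at hs h2
      have := Nat.mul_le_mul (Nat.succ_le_of_lt hs) (Nat.succ_le_of_lt h2)
      rw [Nat.mul_div_cancel' hdk] at this
      exact absurd (Nat.lt_succ_sqrt k) (not_lt.2 this)
  have h1 := (card_le_card h).trans ((card_union_le _ _).trans (add_le_add le_rfl card_image_le))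
  rw [Nat.card_Icc] at h1
  have h2 : (k.divisors.card : ℝ) ≤ 2 * (k.sqrt : ℕ) := by
    have : k.divisors.card ≤ 2 * k.sqrt := by omega
    exact_mod_cast this
  linarith [Real.nat_sqrt_le_real_sqrt (a := k)]

/-- Abel summation against the monotone logarithm. -/
lemma norm_sum_log_mul_le {u : ℕ → ℂ} {M : ℕ} {G : ℝ}
    (h : ∀ Y ≤ M, ‖∑ n ∈ Ioc 0 Y, u n‖ ≤ G) :
    ‖∑ n ∈ Ioc 0 M, (Real.log n : ℂ) * u n‖ ≤ 2 * G * Real.log M := by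
  set S : ℕ → ℂ := fun Y => ∑ n ∈ Ioc 0 Y, u n with hS
  have hparts : ∀ M : ℕ, ∑ n ∈ Ioc 0 M, (Real.log n : ℂ) * u n = (Real.log M : ℂ) * S M -
      ∑ n ∈ range M, ((Real.log (n + 1 : ℕ) - Real.log n : ℝ) : ℂ) * S n := by
    intro M
    induction M with
    | zero => simp
    | succ M ih =>
      have hs : S (M + 1) = S M + u (M + 1) := by
        rw [hS]
        exact sum_Ioc_succ_top (Nat.zero_le M) _
      rw [sum_Ioc_succ_top (Nat.zero_le M), ih, sum_range_succ, hs]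
      push_cast
      ring
  have hlogM : 0 ≤ Real.log M := Real.log_natCast_nonneg M
  rw [hparts]
  have h1 : ‖(Real.log M : ℂ) * S M‖ ≤ Real.log M * G := by
    rw [norm_mul, Complex.norm_real, norm_of_nonneg hlogM]
    gcongr
    exact h M le_rfl
  have h2 : ‖∑ n ∈ range M, ((Real.log (n + 1 : ℕ) - Real.log n : ℝ) : ℂ) * S n‖ ≤
      Real.log M * G := by
    refine (norm_sum_le _ _).trans ?_
    have : ∀ n ∈ range M, ‖((Real.log (n + 1 : ℕ) - Real.log n : ℝ) : ℂ) * S n‖ ≤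
        (Real.log (n + 1 : ℕ) - Real.log n) * G := by
      intro n hn
      have h0 : 0 ≤ Real.log (n + 1 : ℕ) - Real.log n := by
        -- At `n = 0` the increment vanishes, by the convention `log 0 = 0`.
        rcases n.eq_zero_or_pos with rfl | hn0
        · simp
        · rw [sub_nonneg]
          apply Real.log_le_log
          · exact_mod_cast hn0
          · push_cast; linarith
      rw [norm_mul, Complex.norm_real, norm_of_nonneg h0]
      gcongr
      exact h n (mem_range.1 hn).le
    refine (sum_le_sum this).trans ?_
    rw [← sum_mul, sum_range_sub (fun n : ℕ => Real.log n)]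
    simp
  refine (norm_sub_le _ _).trans ?_
  linarith

/-! ### Type I and type II sums -/

lemma norm_typeI_le {N V : ℕ} {A G : ℝ} {a w : ℕ → ℝ} {z : ℕ → ℂ} (hVN : V ≤ N)
    (hA : 0 ≤ A) (hG : 0 ≤ G) (ha : ∀ k, |a k| ≤ A) (ha0 : ∀ k, V < k → a k = 0)
    (hw : ∀ k, 0 < k → k ≤ V → ‖∑ l ∈ Ioc 0 (N / k), (w l : ℂ) * z (k * l)‖ ≤ G * (N / k)) :
    ‖∑ k ∈ Ioc 0 N, (a k : ℂ) * ∑ l ∈ Ioc 0 (N / k), (w l : ℂ) * z (k * l)‖ ≤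
      A * G * N * (1 + Real.log N) := by
  rw [← sum_Ioc_consecutive _ (Nat.zero_le V) hVN]
  rw [sum_eq_zero (s := Ioc V N), add_zero]
  · refine (norm_sum_le _ _).trans ?_
    have : ∀ k ∈ Ioc 0 V, ‖(a k : ℂ) * ∑ l ∈ Ioc 0 (N / k), (w l : ℂ) * z (k * l)‖ ≤
        A * G * N * (k : ℝ)⁻¹ := by
      intro k hk
      have hk := mem_Ioc.1 hk
      rw [norm_mul, Complex.norm_real]
      calc _ ≤ A * (G * (N / k)) :=
            mul_le_mul (ha k) (hw k hk.1 hk.2) (norm_nonneg _) hA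
        _ = _ := by ring
    refine (sum_le_sum this).trans ?_
    rw [← mul_sum]
    gcongr
    exact sum_inv_Ioc_le hVN
  · intro k hk
    rw [ha0 k (mem_Ioc.1 hk).1]
    simp

/-- By superadditivity, `(l + 1)^c ≥ l^c + 1`. Hence the off-diagonal frequencies `α (k^c - l^c)` in
type II sums are never smaller than `α`. -/
lemma one_le_abs_rpow_sub_rpow {c : ℝ} (hc : 1 ≤ c) {k l : ℕ} (h : k ≠ l) :
    1 ≤ |(k : ℝ) ^ c - (l : ℝ) ^ c| := by
  wlog hkl : l < k generalizing k l with H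
  · rw [abs_sub_comm]
    exact H h.symm (by omega)
  have h1 := Real.add_rpow_le_rpow_add (a := (l : ℝ)) (b := 1) (by positivity) (by norm_num) hc
  have h2 : ((l : ℝ) + 1) ^ c ≤ (k : ℝ) ^ c := by
    gcongr
    exact_mod_cast hkl
  rw [one_rpow] at h1
  exact le_trans (by linarith) (le_abs_self _)

/-- Makes the range of `l` independent of `k`, so that the order of summation can be exchanged. -/
lemma sum_extend_Ioc {N K : ℕ} (g : ℕ → ℂ) {k : ℕ} (hk : 0 < k) (hK : 0 < K) (hKk : K ≤ k) :
    ∑ l ∈ Ioc 0 (N / k), g l = ∑ l ∈ Ioc 0 (N / K), if k * l ≤ N then g l else 0 := by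
  rw [← sum_filter]
  congr 1
  ext l
  simp only [mem_filter, mem_Ioc, Nat.le_div_iff_mul_le hk, Nat.le_div_iff_mul_le hK, mul_comm k]
  constructor
  · rintro ⟨h1, h2⟩
    exact ⟨⟨h1, (Nat.mul_le_mul_left l hKk).trans h2⟩, h2⟩
  · rintro ⟨⟨h1, _⟩, h2⟩
    exact ⟨h1, h2⟩

/-- A bilinear block, given bounds for the sums `∑ e (β l ^ c)`. -/
lemma norm_typeII_block_sq_le {c α E lg : ℝ} {N K K' : ℕ} {b g : ℕ → ℝ} (hK : 0 < K)
    (hK' : K' ≤ 2 * K) (hK'N : K' ≤ N) (hE : 0 ≤ E)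
    (hb : ∀ k, |b k| ≤ k.divisors.card) (hg : ∀ l ≤ N, |g l| ≤ lg)
    (hexp : ∀ k ∈ Ioc K K', ∀ l ∈ Ioc K K', k ≠ l → ∀ Y : ℕ, (Y : ℝ) ≤ N / K →
      ‖∑ n ∈ Ioc 0 Y, ePhase (α * ((k : ℝ) ^ c - (l : ℝ) ^ c) * (n : ℝ) ^ c)‖ ≤ E * (N / K)) :
    ‖∑ k ∈ Ioc K K', (b k : ℂ) * ∑ l ∈ Ioc 0 (N / k), (g l : ℂ) *
      ePhase (α * ((k * l : ℕ) : ℝ) ^ c)‖ ^ 2 ≤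
      N ^ 2 * lg ^ 2 * (1 + Real.log N) ^ 2 * (6 * (K : ℝ) ^ (-(1 / 2) : ℝ) + 4 * E) := by
  set a : ℕ → ℕ → ℂ := fun k l =>
    if k * l ≤ N then (b k : ℂ) * ePhase (α * ((k * l : ℕ) : ℝ) ^ c) else 0 with ha
  have hK0 : (0 : ℝ) < K := by exact_mod_cast hK
  set Lr : ℝ := N / K with hLr
  have hLr0 : 0 ≤ Lr := by positivity
  set Lg := 1 + Real.log N with hLg
  have hLg1 : 1 ≤ Lg := by
    have := Real.log_natCast_nonneg N
    linarith
  have hL0 : ((N / K : ℕ) : ℝ) ≤ Lr := Nat.cast_div_le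
  have hT : ∑ k ∈ Ioc K K', (b k : ℂ) * ∑ l ∈ Ioc 0 (N / k), (g l : ℂ) *
      ePhase (α * ((k * l : ℕ) : ℝ) ^ c) = ∑ l ∈ Ioc 0 (N / K), (g l : ℂ) *
      ∑ k ∈ Ioc K K', a k l := by
    simp only [mul_sum]
    rw [sum_comm]
    refine sum_congr rfl fun k hk => ?_
    have hk := mem_Ioc.1 hk
    rw [sum_extend_Ioc _ (by omega) hK hk.1.le]
    refine sum_congr rfl fun l _ => ?_
    simp only [ha]
    split_ifs <;> ring
  have hlN : ∀ l ∈ Ioc 0 (N / K), l ≤ N := fun l hl =>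
    (mem_Ioc.1 hl).2.trans (Nat.div_le_self _ _)
  have hpair : ∀ k ∈ Ioc K K', ∀ k' ∈ Ioc K K',
      ‖∑ l ∈ Ioc 0 (N / K), a k l * (starRingEnd ℂ) (a k' l)‖ ≤
        (if k = k' then Lr * (|b k| * |b k'|) else 0) + E * Lr * (|b k| * |b k'|) := by
    intro k hk k' hk'
    have hk0 : 0 < k := hK.trans (mem_Ioc.1 hk).1
    have hk0' : 0 < k' := hK.trans (mem_Ioc.1 hk').1
    by_cases h : k = k'
    · subst h
      rw [if_pos rfl]
      have : ‖∑ l ∈ Ioc 0 (N / K), a k l * (starRingEnd ℂ) (a k l)‖ ≤ Lr * (|b k| * |b k|) := by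
        have h1 : ∀ l ∈ Ioc 0 (N / K), ‖a k l * (starRingEnd ℂ) (a k l)‖ ≤ |b k| * |b k| := by
          intro l _
          rw [norm_mul, RCLike.norm_conj]
          have : ‖a k l‖ ≤ |b k| := by
            simp only [ha]
            split_ifs
            · simp
            · simp
          gcongr
        refine (norm_sum_le _ _).trans ((sum_le_card_nsmul _ _ _ h1).trans ?_)
        rw [Nat.card_Ioc, Nat.sub_zero, nsmul_eq_mul]
        gcongr
      have : 0 ≤ E * Lr * (|b k| * |b k|) := by positivity
      linarith
    · rw [if_neg h, zero_add]
      -- The two cutoffs merge into `l ≤ N / max k k'`, and the two phases into a single one of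
      -- frequency `α (k^c - k'^c)`.
      have hsum : ∑ l ∈ Ioc 0 (N / K), a k l * (starRingEnd ℂ) (a k' l) =
          ((b k * b k' : ℝ) : ℂ) * ∑ l ∈ Ioc 0 (N / max k k'),
            ePhase (α * ((k : ℝ) ^ c - (k' : ℝ) ^ c) * (l : ℝ) ^ c) := by
        rw [sum_extend_Ioc _ (lt_max_of_lt_left hk0) hK
          ((mem_Ioc.1 hk).1.le.trans (le_max_left _ _)), mul_sum]
        refine sum_congr rfl fun l _ => ?_
        have hmax : max k k' * l ≤ N ↔ k * l ≤ N ∧ k' * l ≤ N := by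
          rw [max_mul_of_nonneg _ _ (Nat.zero_le l), max_le_iff]
        simp only [ha, hmax]
        by_cases h1 : k * l ≤ N <;> by_cases h2 : k' * l ≤ N <;> simp only [h1, h2, if_true,
          if_false, and_self, and_true, and_false, map_zero, mul_zero, zero_mul]
        rw [map_mul, Complex.conj_ofReal]
        have : α * ((k : ℝ) ^ c - (k' : ℝ) ^ c) * (l : ℝ) ^ c =
            α * ((k * l : ℕ) : ℝ) ^ c - α * ((k' * l : ℕ) : ℝ) ^ c := by
          push_cast
          rw [mul_rpow (by positivity) (by positivity), mul_rpow (by positivity) (by positivity)]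
          ring
        rw [this, ePhase_sub]
        push_cast
        ring
      rw [hsum, norm_mul, Complex.norm_real, norm_eq_abs, abs_mul]
      have h3 : ((N / max k k' : ℕ) : ℝ) ≤ N / K := by
        refine le_trans ?_ hL0
        exact_mod_cast Nat.div_le_div_left ((mem_Ioc.1 hk).1.le.trans (le_max_left _ _)) hK
      have := hexp k hk k' hk' h _ h3
      rw [mul_comm (E * Lr)]
      gcongr
  set D := ∑ k ∈ Ioc K K', |b k| with hD
  have hD0 : 0 ≤ D := sum_nonneg fun _ _ => abs_nonneg _
  have hK'r : (K' : ℝ) ≤ 2 * K := by exact_mod_cast hK'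
  have hDle : D ≤ 2 * K * Lg := by
    calc D ≤ ∑ k ∈ Ioc K K', (k.divisors.card : ℝ) := sum_le_sum fun k _ => hb k
      _ ≤ ∑ k ∈ Ioc 0 K', (k.divisors.card : ℝ) := by
          apply sum_le_sum_of_subset_of_nonneg
          · exact Ioc_subset_Ioc_left (Nat.zero_le _)
          · intro _ _ _; positivity
      _ ≤ K' * Lg := sum_card_divisors_le hK'N
      _ ≤ _ := by gcongr
  -- The pointwise divisor bound on one factor is enough: the diagonal needs only some power saving
  -- in `K`.
  have hsq : ∑ k ∈ Ioc K K', |b k| * |b k| ≤ 3 * (K : ℝ) ^ (1 / 2 : ℝ) * D := by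
    rw [hD, mul_sum]
    refine sum_le_sum fun k hk => ?_
    gcongr
    refine (hb k).trans ((card_divisors_le_two_mul_sqrt k).trans ?_)
    have hk2 : (k : ℝ) ≤ 2 * K := by
      have : (k : ℝ) ≤ K' := by exact_mod_cast (mem_Ioc.1 hk).2
      linarith
    rw [← sqrt_eq_rpow]
    have : √(k : ℝ) ≤ 3 / 2 * √(K : ℝ) := by
      rw [sqrt_le_left (by positivity), mul_pow, sq_sqrt hK0.le]
      linarith
    linarith
  have hlg2 : ∑ l ∈ Ioc 0 (N / K), ‖(g l : ℂ)‖ ^ 2 ≤ Lr * lg ^ 2 := by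
    have : ∀ l ∈ Ioc 0 (N / K), ‖(g l : ℂ)‖ ^ 2 ≤ lg ^ 2 := by
      intro l hl
      rw [Complex.norm_real, norm_eq_abs]
      gcongr
      exact hg l (hlN l hl)
    refine (sum_le_card_nsmul _ _ _ this).trans ?_
    rw [Nat.card_Ioc, Nat.sub_zero, nsmul_eq_mul]
    gcongr
  have hinner : ∑ l ∈ Ioc 0 (N / K), ‖∑ k ∈ Ioc K K', a k l‖ ^ 2 ≤
      Lr * (3 * (K : ℝ) ^ (1 / 2 : ℝ) * D) + E * Lr * D ^ 2 := by
    refine (sum_norm_sq_sum_le _ _ _).trans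
      ((sum_le_sum fun k hk => sum_le_sum fun k' hk' => hpair k hk k' hk').trans ?_)
    simp only [sum_add_distrib]
    gcongr ?_ + ?_
    · refine le_trans (le_of_eq ?_) (mul_le_mul_of_nonneg_left hsq hLr0)
      rw [mul_sum]
      refine sum_congr rfl fun k hk => ?_
      rw [sum_ite_eq, if_pos hk]
    · rw [sq, hD, sum_mul_sum, mul_sum]
      exact le_of_eq (sum_congr rfl fun k _ => by rw [mul_sum])
  rw [hT]
  calc _ ≤ (∑ l ∈ Ioc 0 (N / K), ‖(g l : ℂ)‖ * ‖∑ k ∈ Ioc K K', a k l‖) ^ 2 := by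
        gcongr
        refine (norm_sum_le _ _).trans (le_of_eq (sum_congr rfl fun l _ => norm_mul _ _))
    _ ≤ (∑ l ∈ Ioc 0 (N / K), ‖(g l : ℂ)‖ ^ 2) *
        ∑ l ∈ Ioc 0 (N / K), ‖∑ k ∈ Ioc K K', a k l‖ ^ 2 := sum_mul_sq_le_sq_mul_sq _ _ _
    _ ≤ (Lr * lg ^ 2) * (Lr * (3 * (K : ℝ) ^ (1 / 2 : ℝ) * D) + E * Lr * D ^ 2) := by
        gcongr
    _ ≤ (Lr * lg ^ 2) * (Lr * (3 * (K : ℝ) ^ (1 / 2 : ℝ) * (2 * K * Lg)) +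
        E * Lr * (2 * K * Lg) ^ 2) := by gcongr
    _ = (Lr * K) ^ 2 * lg ^ 2 * (6 * ((K : ℝ) ^ (1 / 2 : ℝ) / K) * Lg + 4 * E * Lg ^ 2) := by
        field_simp
        ring
    _ ≤ _ := by
        have e1 : Lr * K = N := by rw [hLr]; field_simp
        have e2 : (K : ℝ) ^ (1 / 2 : ℝ) / K = (K : ℝ) ^ (-(1 / 2) : ℝ) := by
          rw [← rpow_sub_one hK0.ne']; norm_num
        rw [e1, e2]
        have : 6 * (K : ℝ) ^ (-(1 / 2) : ℝ) * Lg ≤ 6 * (K : ℝ) ^ (-(1 / 2) : ℝ) * Lg ^ 2 := by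
          gcongr
          nlinarith
        calc _ ≤ (N : ℝ) ^ 2 * lg ^ 2 * (6 * (K : ℝ) ^ (-(1 / 2) : ℝ) * Lg ^ 2 +
              4 * E * Lg ^ 2) := by gcongr
          _ = _ := by ring

/-! ### Power saving for exponential sums weighted by `Λ` -/

/-- Restates the saving in powers of `N` for sums of length up to `X ≥ N ^ (1/8)`. Since `N ≤ X ^
8`, the exponent `(c - 1) / 2` becomes `(c - 1) / 16`. -/
lemma exists_norm_sum_rpow_le_mul {c : ℝ} (hc : 1 < c) (hcZ : ∀ k : ℤ, c ≠ k) :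
    ∃ η : ℝ, 0 < η ∧ η ≤ 1 / 16 ∧ ∃ C : ℝ, 0 ≤ C ∧ ∀ (N X β : ℝ) (Y : ℕ), 1 ≤ N →
      N ^ (1 / 8 : ℝ) ≤ X → Y ≤ X →
      N ^ (-((c - 1) / 16)) ≤ |β| → |β| ≤ N ^ ((c - 1) / 16 + c) →
      ‖∑ n ∈ Ioc 0 Y, ePhase (β * (n : ℝ) ^ c)‖ ≤ C * N ^ (-η) * X := by
  obtain ⟨η, h0, h1, C, hC0, hC⟩ := exists_norm_sum_rpow_le hc hcZ (8 * ((c - 1) / 16 + c))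
  refine ⟨η / 8, by positivity, by linarith, C, hC0, ?_⟩
  intro N X β Y hN hNX hYX hβ1 hβ2
  have hN0 : 0 < N := by linarith
  have hX : 1 ≤ X := (one_le_rpow hN (by norm_num)).trans hNX
  have hX0 : 0 < X := by linarith
  have hNX8 : N ≤ X ^ (8 : ℝ) := by
    calc N = (N ^ (1 / 8 : ℝ)) ^ (8 : ℝ) := by rw [← rpow_mul hN0.le]; norm_num
      _ ≤ _ := by gcongr
  refine (hC X β Y hX hYX ?_ ?_).trans ?_
  · refine le_trans ?_ hβ1
    calc X ^ (-((c - 1) / 2)) = (X ^ (8 : ℝ)) ^ (-((c - 1) / 16)) := by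
          rw [← rpow_mul hX0.le]; ring_nf
      _ ≤ _ := rpow_le_rpow_of_nonpos hN0 hNX8 (by linarith)
  · refine hβ2.trans ?_
    rw [rpow_mul hX0.le]
    exact rpow_le_rpow hN0.le hNX8 (by linarith)
  · have : X ^ (-η) ≤ N ^ (-(η / 8)) := by
      calc X ^ (-η) ≤ (N ^ (1 / 8 : ℝ)) ^ (-η) :=
            rpow_le_rpow_of_nonpos (by positivity) hNX (by linarith)
        _ = _ := by rw [← rpow_mul hN0.le]; ring_nf
    rw [sub_eq_add_neg, rpow_add hX0, rpow_one]
    calc C * (X * X ^ (-η)) ≤ C * (X * N ^ (-(η / 8))) := by gcongr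
      _ = _ := by ring

lemma sum_dyadic {V N J : ℕ} (u : ℕ → ℂ) (hVN : V ≤ N) (hJ : N ≤ V * 2 ^ J) :
    ∑ k ∈ Ioc V N, u k =
      ∑ j ∈ range J, ∑ k ∈ Ioc (min (V * 2 ^ j) N) (min (V * 2 ^ (j + 1)) N), u k := by
  have h : ∀ J, ∑ k ∈ Ioc V (min (V * 2 ^ J) N), u k =
      ∑ j ∈ range J, ∑ k ∈ Ioc (min (V * 2 ^ j) N) (min (V * 2 ^ (j + 1)) N), u k := by
    intro J
    induction J with
    | zero => simp [hVN]
    | succ J ih =>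
      rw [sum_range_succ, ← ih, sum_Ioc_consecutive]
      · exact le_min (Nat.le_mul_of_pos_right _ (by positivity)) hVN
      · apply min_le_min_right
        rw [pow_succ]
        exact Nat.mul_le_mul_left _ (by omega)
  rw [← h J, min_eq_right hJ]

lemma arithmeticFunction_sub_apply (f g : ArithmeticFunction ℝ) (n : ℕ) :
    (f - g) n = f n - g n := by
  have := congrArg (fun h : ArithmeticFunction ℝ => h n) (sub_add_cancel f g)
  simp only [ArithmeticFunction.add_apply] at this
  linarith

lemma abs_lowPart_moebius_mul_zeta_le (V k : ℕ) :
    |(((μ : ArithmeticFunction ℝ) - lowPart V (μ : ArithmeticFunction ℝ)) *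
      (ζ : ArithmeticFunction ℝ)) k| ≤ k.divisors.card := by
  rw [ArithmeticFunction.coe_mul_zeta_apply]
  refine (abs_sum_le_sum_abs _ _).trans ?_
  have : ∀ d ∈ k.divisors, |((μ : ArithmeticFunction ℝ) -
      lowPart V (μ : ArithmeticFunction ℝ)) d| ≤ 1 := by
    intro d _
    rw [arithmeticFunction_sub_apply, lowPart_apply]
    have h1 : |((μ : ArithmeticFunction ℝ) d)| ≤ 1 := by
      rw [ArithmeticFunction.intCoe_apply]
      exact_mod_cast ArithmeticFunction.abs_moebius_le_one (n := d)
    split_ifs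
    · simp
    · simpa using h1
  refine (sum_le_card_nsmul _ _ _ this).trans ?_
  simp

lemma lowPart_moebius_mul_zeta_eq_zero {V k : ℕ} (h : k ≤ V) :
    (((μ : ArithmeticFunction ℝ) - lowPart V (μ : ArithmeticFunction ℝ)) *
      (ζ : ArithmeticFunction ℝ)) k = 0 := by
  rw [ArithmeticFunction.coe_mul_zeta_apply]
  refine sum_eq_zero fun d hd => ?_
  rw [arithmeticFunction_sub_apply, lowPart_apply, if_pos ((Nat.divisor_le hd).trans h), sub_self]

lemma abs_lowPart_moebius_le (V k : ℕ) : |lowPart V (μ : ArithmeticFunction ℝ) k| ≤ 1 := by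
  rw [lowPart_apply]
  split_ifs
  · rw [ArithmeticFunction.intCoe_apply]
    exact_mod_cast ArithmeticFunction.abs_moebius_le_one (n := k)
  · simp

lemma lowPart_vonMangoldt_le (V k : ℕ) : |lowPart V Λ k| ≤ Λ k := by
  rw [lowPart_apply]
  split_ifs
  · rw [abs_of_nonneg ArithmeticFunction.vonMangoldt_nonneg]
  · simp

lemma abs_lowPart_mul_lowPart_le (V k : ℕ) :
    |(lowPart V (μ : ArithmeticFunction ℝ) * lowPart V Λ) k| ≤ Real.log k := by
  rw [ArithmeticFunction.mul_apply, ← ArithmeticFunction.vonMangoldt_sum,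
    ← Nat.sum_divisorsAntidiagonal' (f := fun _ e => Λ e)]
  refine (abs_sum_le_sum_abs _ _).trans (sum_le_sum fun x _ => ?_)
  rw [abs_mul]
  have h1 := abs_lowPart_moebius_le V x.1
  have h2 := lowPart_vonMangoldt_le V x.2
  calc _ ≤ 1 * Λ x.2 := by gcongr
    _ = _ := one_mul _

lemma lowPart_mul_lowPart_eq_zero {V k : ℕ} (f g : ArithmeticFunction ℝ) (h : V * V < k) :
    (lowPart V f * lowPart V g) k = 0 := by
  rw [ArithmeticFunction.mul_apply]
  refine sum_eq_zero fun x hx => ?_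
  have hx := (Nat.mem_divisorsAntidiagonal.1 hx).1
  rw [lowPart_apply, lowPart_apply]
  by_cases h1 : x.1 ≤ V
  · by_cases h2 : x.2 ≤ V
    · have := Nat.mul_le_mul h1 h2
      omega
    · rw [if_neg h2, mul_zero]
  · rw [if_neg h1, zero_mul]

lemma sum_vonMangoldt_le (N : ℕ) : ∑ n ∈ Ioc 0 N, Λ n ≤ 6 * N := by
  have h2 := Chebyshev.psi_le_const_mul_self (x := (N : ℝ)) (by positivity)
  rw [Chebyshev.psi, Nat.floor_natCast] at h2
  have h3 : Real.log 4 ≤ 2 := by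
    rw [show (4 : ℝ) = 2 ^ 2 by norm_num, Real.log_pow]
    have := Real.log_two_lt_d9
    push_cast
    linarith
  have : (0 : ℝ) ≤ N := by positivity
  nlinarith

set_option maxHeartbeats 1000000 in
lemma norm_sum_vonMangoldt_le {c α E θ : ℝ} {N : ℕ} (hc : 1 ≤ c) (hN : 256 ≤ N) (hE : 0 ≤ E)
    (hexp : ∀ (X β : ℝ) (Y : ℕ), (N : ℝ) ^ (1 / 8 : ℝ) ≤ X → Y ≤ X →
      (N : ℝ) ^ (-θ) ≤ |β| → |β| ≤ (N : ℝ) ^ (θ + c) →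
      ‖∑ n ∈ Ioc 0 Y, ePhase (β * (n : ℝ) ^ c)‖ ≤ E * X)
    (hα1 : (N : ℝ) ^ (-θ) ≤ α) (hα2 : α ≤ (N : ℝ) ^ θ) :
    ‖∑ n ∈ Ioc 0 N, (Λ n : ℂ) * ePhase (α * (n : ℝ) ^ c)‖ ≤
      12 * (N : ℝ) ^ (1 / 8 : ℝ) + 3 * E * N * (1 + Real.log N) ^ 2 +
        2 * N * (1 + Real.log N) ^ 3 * √(6 * (N : ℝ) ^ (-(1 / 16) : ℝ) + 4 * E) := by
  have hNr : (256 : ℝ) ≤ N := by exact_mod_cast hN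
  have hN0 : (0 : ℝ) < N := by linarith
  -- The Vaughan cutoff is `⌈t⌉`. The hypothesis `256 ≤ N` gives `t ≥ 2`, so `V * V ≤ t ^ 4 = N ^
  -- (1/2)`, and the type I inner sums have nominal length `N / k ≥ t ^ 4`.
  set t := (N : ℝ) ^ (1 / 8 : ℝ) with ht
  have ht0 : 0 < t := by positivity
  have ht8 : t ^ 8 = N := by
    rw [ht, ← rpow_natCast, ← rpow_mul hN0.le]; norm_num
  have ht2 : 2 ≤ t := by
    by_contra h
    push Not at h
    have : t ^ 8 < 2 ^ 8 := by gcongr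
    norm_num at this
    linarith
  set V := ⌈t⌉₊ with hV
  have htV : t ≤ V := Nat.le_ceil _
  have hV2 : (V : ℝ) ≤ 2 * t := by
    have := Nat.ceil_lt_add_one ht0.le
    linarith
  have hV0 : 0 < V := Nat.ceil_pos.2 ht0
  have hVV : ((V * V : ℕ) : ℝ) ≤ t ^ 4 := by
    push_cast
    calc (V : ℝ) * V ≤ (2 * t) * (2 * t) := by gcongr
      _ = 2 * 2 * t ^ 2 := by ring
      _ ≤ t * t * t ^ 2 := by gcongr
      _ = _ := by ring
  have ht4 : t ^ 4 ≤ N := by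
    rw [← ht8]
    exact pow_le_pow_right₀ (by linarith) (by norm_num)
  have hVVN : V * V ≤ N := by
    have : ((V * V : ℕ) : ℝ) ≤ N := hVV.trans ht4
    exact_mod_cast this
  have hVVV : V ≤ V * V := Nat.le_mul_of_pos_right _ hV0
  have hVN : V ≤ N := hVVV.trans hVVN
  set Lg := 1 + Real.log N with hLg
  have hlog0 := Real.log_natCast_nonneg N
  have hLg1 : 1 ≤ Lg := by linarith
  have hlogle : ∀ k : ℕ, k ≤ N → Real.log k ≤ Real.log N := by
    intro k hk
    rcases k.eq_zero_or_pos with rfl | hk0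
    · simpa using hlog0
    · apply Real.log_le_log
      · exact_mod_cast hk0
      · exact_mod_cast hk
  have hα0 : 0 < α := lt_of_lt_of_le (by positivity) hα1
  have hαN : α * (N : ℝ) ^ c ≤ (N : ℝ) ^ (θ + c) := by
    rw [rpow_add hN0]; gcongr
  set z : ℕ → ℂ := fun n => ePhase (α * (n : ℝ) ^ c) with hz
  have hzmul : ∀ k l : ℕ, z (k * l) = ePhase (α * (k : ℝ) ^ c * (l : ℝ) ^ c) := by
    intro k l
    simp only [hz]
    push_cast
    rw [mul_rpow (by positivity) (by positivity), mul_assoc]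
  have hlin : ∀ k : ℕ, 0 < k → k ≤ V * V → ∀ Y ≤ N / k,
      ‖∑ l ∈ Ioc 0 Y, z (k * l)‖ ≤ E * (N / k) := by
    intro k hk0 hkV Y hY
    simp only [hzmul]
    have hk1 : (1 : ℝ) ≤ k := by exact_mod_cast hk0
    have hkr : (k : ℝ) ≤ t ^ 4 := by
      refine le_trans ?_ hVV
      exact_mod_cast hkV
    have hkN : (k : ℝ) ≤ N := hkr.trans ht4
    have hβ0 : 0 ≤ α * (k : ℝ) ^ c := by positivity
    apply hexp
    · rw [le_div_iff₀ (by linarith)]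
      calc t * k ≤ t ^ 4 * t ^ 4 := by
            gcongr
            exact le_self_pow₀ (by linarith) (by norm_num)
        _ = N := by rw [← ht8]; ring
    · calc (Y : ℝ) ≤ (N / k : ℕ) := by exact_mod_cast hY
        _ ≤ _ := Nat.cast_div_le
    · rw [abs_of_nonneg hβ0]
      refine hα1.trans ?_
      have := one_le_rpow hk1 (show 0 ≤ c by linarith)
      nlinarith
    · rw [abs_of_nonneg hβ0]
      refine le_trans ?_ hαN
      gcongr
  have hI1 : ‖∑ n ∈ Ioc 0 N, ((lowPart V (μ : ArithmeticFunction ℝ) *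
      ArithmeticFunction.log) n : ℂ) * z n‖ ≤ 2 * E * N * Lg ^ 2 := by
    rw [sum_Ioc_conv_mul]
    refine (norm_typeI_le (V := V * V) (A := 1) (G := 2 * E * Lg) hVVN zero_le_one (by positivity)
      (abs_lowPart_moebius_le V) ?_ ?_).trans (le_of_eq ?_)
    · intro k hk
      rw [lowPart_apply, if_neg (by omega)]
    · intro k hk0 hkV
      simp only [ArithmeticFunction.log_apply]
      refine (norm_sum_log_mul_le (hlin k hk0 hkV)).trans ?_
      have h1 := hlogle (N / k) (Nat.div_le_self _ _)
      have : 0 ≤ E * (N / k) := by positivity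
      nlinarith
    · ring
  have hI2 : ‖∑ n ∈ Ioc 0 N, (((lowPart V (μ : ArithmeticFunction ℝ) * lowPart V Λ) *
      (ζ : ArithmeticFunction ℝ)) n : ℂ) * z n‖ ≤ E * N * Lg ^ 2 := by
    rw [sum_Ioc_conv_mul]
    refine (norm_typeI_le (V := V * V) (A := Lg) (G := E) hVVN (by linarith) hE
      ?_ ?_ ?_).trans (le_of_eq ?_)
    · intro k
      by_cases hk : V * V < k
      · rw [lowPart_mul_lowPart_eq_zero _ _ hk, abs_zero]
        linarith
      · refine (abs_lowPart_mul_lowPart_le V k).trans ?_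
        have := hlogle k (by omega)
        linarith
    · intro k hk
      exact lowPart_mul_lowPart_eq_zero _ _ hk
    · intro k hk0 hkV
      refine le_trans (le_of_eq ?_) (hlin k hk0 hkV _ le_rfl)
      congr 1
      refine sum_congr rfl fun l hl => ?_
      rw [ArithmeticFunction.natCoe_apply, ArithmeticFunction.zeta_apply_ne
        (mem_Ioc.1 hl).1.ne']
      simp
    · ring
  have h0 : ‖∑ n ∈ Ioc 0 N, (lowPart V Λ n : ℂ) * z n‖ ≤ 12 * t := by
    rw [← sum_Ioc_consecutive _ (Nat.zero_le V) hVN]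
    rw [sum_eq_zero (s := Ioc V N), add_zero]
    · have h1 : ∀ n ∈ Ioc 0 V, ‖(lowPart V Λ n : ℂ) * z n‖ ≤ Λ n := by
        intro n _
        rw [norm_mul, Complex.norm_real, hz, norm_ePhase, mul_one]
        exact lowPart_vonMangoldt_le V n
      refine (norm_sum_le _ _).trans ((sum_le_sum h1).trans ?_)
      have h2 := sum_vonMangoldt_le V
      linarith
    · intro n hn
      rw [lowPart_apply, if_neg (by have := mem_Ioc.1 hn; omega)]
      simp
  set b : ArithmeticFunction ℝ := ((μ : ArithmeticFunction ℝ) -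
    lowPart V (μ : ArithmeticFunction ℝ)) * (ζ : ArithmeticFunction ℝ) with hb
  set g : ArithmeticFunction ℝ := Λ - lowPart V Λ with hg
  have hgle : ∀ l ≤ N, |g l| ≤ Lg := by
    intro l hl
    have h1 : |g l| ≤ Real.log N := by
      rw [hg, arithmeticFunction_sub_apply, lowPart_apply]
      split_ifs
      · simpa using hlog0
      · rw [sub_zero, abs_of_nonneg ArithmeticFunction.vonMangoldt_nonneg]
        exact ArithmeticFunction.vonMangoldt_le_log.trans (hlogle l hl)
    linarith
  have hg0 : ∀ l ≤ V, g l = 0 := by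
    intro l hl
    rw [hg, arithmeticFunction_sub_apply, lowPart_apply, if_pos hl, sub_self]
  set Q := √(6 * (N : ℝ) ^ (-(1 / 16) : ℝ) + 4 * E) with hQ
  have hblock : ∀ K K' : ℕ, V ≤ K → K' ≤ 2 * K → K' ≤ N →
      ‖∑ k ∈ Ioc K K', (b k : ℂ) * ∑ l ∈ Ioc 0 (N / k), (g l : ℂ) * z (k * l)‖ ≤
        N * Lg ^ 2 * Q := by
    intro K K' hVK hK' hK'N
    have hK0 : 0 < K := by omega
    have hK0r : (0 : ℝ) < K := by exact_mod_cast hK0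
    -- In a nonzero term `k > K`, `l > V` and `k * l ≤ N`. So either the block is empty, or `N / K ≥
    -- V ≥ t` and the inner sums are long enough.
    by_cases hKV : N ≤ K * V
    · rw [sum_eq_zero]
      · rw [norm_zero]; positivity
      · intro k hk
        rw [sum_eq_zero, mul_zero]
        intro l hl
        have hk := (mem_Ioc.1 hk).1
        have hl := (mem_Ioc.1 hl).2
        rw [Nat.le_div_iff_mul_le (by omega)] at hl
        rw [hg0 l]
        · simp
        · by_contra h
          push Not at h
          have : V * K < l * k := Nat.mul_lt_mul'' h hk
          rw [mul_comm] at this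
          omega
    push Not at hKV
    have hX : t ≤ (N : ℝ) / K := by
      rw [le_div_iff₀ hK0r]
      have : (K : ℝ) * V ≤ N := by exact_mod_cast hKV.le
      nlinarith
    have hsq := norm_typeII_block_sq_le (c := c) (α := α) (E := E) (lg := Lg) hK0 hK' hK'N hE
      (abs_lowPart_moebius_mul_zeta_le V) hgle (by
        intro k hk l hl hkl Y hY
        have hkN : (k : ℝ) ≤ N := by exact_mod_cast (mem_Ioc.1 hk).2.trans hK'N
        have hlN : (l : ℝ) ≤ N := by exact_mod_cast (mem_Ioc.1 hl).2.trans hK'N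
        apply hexp _ _ _ hX hY
        · rw [abs_mul, abs_of_pos hα0]
          have := one_le_abs_rpow_sub_rpow hc hkl
          nlinarith
        · rw [abs_mul, abs_of_pos hα0]
          refine le_trans ?_ hαN
          gcongr
          have e1 : (k : ℝ) ^ c ≤ (N : ℝ) ^ c := by gcongr
          have e2 : (l : ℝ) ^ c ≤ (N : ℝ) ^ c := by gcongr
          have e3 : 0 ≤ (k : ℝ) ^ c := by positivity
          have e4 : 0 ≤ (l : ℝ) ^ c := by positivity
          exact abs_sub_le_of_nonneg_of_le e3 e1 e4 e2)
    refine (sq_le_sq₀ (norm_nonneg _) (by positivity)).1 (hsq.trans ?_)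
    have hKt : (K : ℝ) ^ (-(1 / 2) : ℝ) ≤ (N : ℝ) ^ (-(1 / 16) : ℝ) := by
      calc (K : ℝ) ^ (-(1 / 2) : ℝ) ≤ t ^ (-(1 / 2) : ℝ) := by
            apply rpow_le_rpow_of_nonpos ht0 _ (by norm_num)
            exact htV.trans (by exact_mod_cast hVK)
        _ = _ := by rw [ht, ← rpow_mul hN0.le]; norm_num
    rw [mul_pow, mul_pow, hQ, sq_sqrt (by positivity)]
    calc _ ≤ (N : ℝ) ^ 2 * Lg ^ 2 * Lg ^ 2 * (6 * (N : ℝ) ^ (-(1 / 16) : ℝ) + 4 * E) := by gcongr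
      _ = _ := by ring
  have hII : ‖∑ n ∈ Ioc 0 N, ((b * g) n : ℂ) * z n‖ ≤ 2 * N * Lg ^ 3 * Q := by
    rw [sum_Ioc_conv_mul]
    rw [← sum_Ioc_consecutive _ (Nat.zero_le V) hVN]
    rw [sum_eq_zero (s := Ioc 0 V), zero_add]
    -- Since `log 2 > 1/2`, this many doublings exceed `N`.
    · set J := ⌈2 * Real.log N⌉₊ with hJ
      have hJ2 : (J : ℝ) ≤ 2 * Lg := by
        have := Nat.ceil_lt_add_one (show 0 ≤ 2 * Real.log N by positivity)
        linarith
      have hJN : N ≤ V * 2 ^ J := by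
        have h1 : (N : ℝ) ≤ 2 ^ J := by
          calc (N : ℝ) = Real.exp (Real.log N) := (Real.exp_log hN0).symm
            _ ≤ Real.exp (J * Real.log 2) := by
                apply Real.exp_le_exp.2
                have h2 := Nat.le_ceil (2 * Real.log N)
                have h3 := Real.log_two_gt_d9
                have h4 : 2 * Real.log N * (1 / 2) ≤ J * Real.log 2 := by
                  gcongr
                  linarith
                linarith
            _ = 2 ^ J := by
                rw [mul_comm, Real.exp_mul, Real.exp_log (by norm_num), rpow_natCast]
        have h2 : N ≤ 2 ^ J := by exact_mod_cast h1
        exact h2.trans (Nat.le_mul_of_pos_left _ hV0)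
      rw [sum_dyadic _ hVN hJN]
      refine (norm_sum_le _ _).trans ((sum_le_card_nsmul _ _ (N * Lg ^ 2 * Q) ?_).trans ?_)
      · intro j _
        apply hblock
        · exact le_min (Nat.le_mul_of_pos_right _ (by positivity)) hVN
        · rw [pow_succ, ← mul_assoc]
          omega
        · exact min_le_right _ _
      · rw [card_range, nsmul_eq_mul]
        calc (J : ℝ) * (N * Lg ^ 2 * Q) ≤ (2 * Lg) * (N * Lg ^ 2 * Q) := by gcongr
          _ = _ := by ring
    · intro k hk
      rw [hb, lowPart_moebius_mul_zeta_eq_zero (mem_Ioc.1 hk).2]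
      simp
  have hdecomp : ∑ n ∈ Ioc 0 N, (Λ n : ℂ) * z n =
      ∑ n ∈ Ioc 0 N, (lowPart V Λ n : ℂ) * z n +
      ∑ n ∈ Ioc 0 N, ((lowPart V (μ : ArithmeticFunction ℝ) *
        ArithmeticFunction.log) n : ℂ) * z n -
      ∑ n ∈ Ioc 0 N, (((lowPart V (μ : ArithmeticFunction ℝ) * lowPart V Λ) *
        (ζ : ArithmeticFunction ℝ)) n : ℂ) * z n +
      ∑ n ∈ Ioc 0 N, ((b * g) n : ℂ) * z n := by
    rw [← sum_add_distrib, ← sum_sub_distrib, ← sum_add_distrib]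
    refine sum_congr rfl fun n _ => ?_
    have := congrArg (fun f : ArithmeticFunction ℝ => ((f n : ℝ) : ℂ)) (vaughan V)
    simp only [← hb, ← hg, ArithmeticFunction.add_apply, arithmeticFunction_sub_apply] at this
    rw [this]
    push_cast
    ring
  rw [hdecomp]
  refine (norm_add_le _ _).trans ((add_le_add ((norm_sub_le _ _).trans
    (add_le_add ((norm_add_le _ _).trans (add_le_add h0 hI1)) hI2)) hII).trans ?_)
  linarith

lemma exists_one_add_log_pow_le (k : ℕ) {ε : ℝ} (hε : 0 < ε) : ∃ C : ℝ, 0 < C ∧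
    ∀ N : ℕ, 1 ≤ N → (1 + Real.log N) ^ k ≤ C * (N : ℝ) ^ ε := by
  set r := ε / (k + 1) with hr
  have hr0 : 0 < r := by positivity
  refine ⟨(1 + 1 / r) ^ k, by positivity, ?_⟩
  intro N hN
  have hN1 : (1 : ℝ) ≤ N := by exact_mod_cast hN
  have h1 := Real.log_le_rpow_div (x := (N : ℝ)) (by positivity) hr0
  have h2 : 1 ≤ (N : ℝ) ^ r := one_le_rpow hN1 hr0.le
  have h3 := Real.log_natCast_nonneg N
  calc (1 + Real.log N) ^ k ≤ ((1 + 1 / r) * (N : ℝ) ^ r) ^ k := by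
        gcongr
        rw [add_mul, one_mul, one_div_mul_eq_div]
        linarith
    _ = (1 + 1 / r) ^ k * (N : ℝ) ^ (r * k) := by
        rw [mul_pow, ← rpow_natCast ((N : ℝ) ^ r), ← rpow_mul (by positivity)]
    _ ≤ _ := by
        gcongr
        rw [hr, div_mul_eq_mul_div, div_le_iff₀ (by positivity)]
        nlinarith

/-- Power saving for `∑ Λ(n) e (α n ^ c)`, for `α` near `1` on the power scale. -/
theorem exists_norm_sum_vonMangoldt_le {c : ℝ} (hc : 1 < c) (hcZ : ∀ k : ℤ, c ≠ k) :
    ∃ θ : ℝ, 0 < θ ∧ ∃ η : ℝ, 0 < η ∧ η ≤ 1 ∧ ∃ C : ℝ, 0 ≤ C ∧ ∀ (N : ℕ) (α : ℝ), 1 ≤ N →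
      (N : ℝ) ^ (-θ) ≤ α → α ≤ (N : ℝ) ^ θ →
      ‖∑ n ∈ Ioc 0 N, (Λ n : ℂ) * ePhase (α * (n : ℝ) ^ c)‖ ≤ C * (N : ℝ) ^ (1 - η) := by
  obtain ⟨η, h0, h1, C, hC0, hC⟩ := exists_norm_sum_rpow_le_mul hc hcZ
  obtain ⟨D, hD0, hD⟩ := exists_one_add_log_pow_le 3 (show 0 < η / 4 by positivity)
  -- The square root in the type II bound leaves `N ^ (-η/2)`, and the logarithms cost at most `N ^
  -- (η/4)`. The summand `1536 = 6 * 256` covers `N < 256` trivially.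
  refine ⟨(c - 1) / 16, by linarith, η / 4, by positivity, by linarith,
    1536 + 12 + 3 * C * D + 2 * D * √(6 + 4 * C), by positivity, ?_⟩
  intro N α hN hα1 hα2
  have hN1 : (1 : ℝ) ≤ N := by exact_mod_cast hN
  have hN0 : (0 : ℝ) < N := by linarith
  set W := (N : ℝ) ^ (1 - η / 4) with hW
  have hW1 : 1 ≤ W := one_le_rpow hN1 (by linarith)
  rcases lt_or_ge N 256 with hs | hs
  · have hb : ‖∑ n ∈ Ioc 0 N, (Λ n : ℂ) * ePhase (α * (n : ℝ) ^ c)‖ ≤ 6 * N := by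
      refine (norm_sum_le _ _).trans (le_trans (le_of_eq ?_) (sum_vonMangoldt_le N))
      refine sum_congr rfl fun n _ => ?_
      rw [norm_mul, norm_ePhase, mul_one, Complex.norm_real,
        norm_of_nonneg ArithmeticFunction.vonMangoldt_nonneg]
    have : (N : ℝ) ≤ 256 := by exact_mod_cast hs.le
    have h2 : 0 ≤ 12 + 3 * C * D + 2 * D * √(6 + 4 * C) := by positivity
    nlinarith
  have key := norm_sum_vonMangoldt_le (E := C * (N : ℝ) ^ (-η)) hc.le hs (by positivity)
    (fun X β Y hX hY hβ1 hβ2 => hC N X β Y hN1 hX hY hβ1 hβ2) hα1 hα2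
  refine key.trans ?_
  set Lg := 1 + Real.log N with hLg
  have hLg1 : 1 ≤ Lg := by
    have := Real.log_natCast_nonneg N
    linarith
  have hL3 : Lg ^ 3 ≤ D * (N : ℝ) ^ (η / 4) := hD N hN
  have hL2 : Lg ^ 2 ≤ D * (N : ℝ) ^ (η / 4) :=
    (pow_le_pow_right₀ hLg1 (by norm_num)).trans hL3
  have t1 : (N : ℝ) ^ (1 / 8 : ℝ) ≤ W := rpow_le_rpow_of_exponent_le hN1 (by linarith)
  have t2 : 3 * (C * (N : ℝ) ^ (-η)) * N * Lg ^ 2 ≤ 3 * C * D * W := by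
    calc _ ≤ 3 * (C * (N : ℝ) ^ (-η)) * N * (D * (N : ℝ) ^ (η / 4)) := by gcongr
      _ = 3 * C * D * ((N : ℝ) ^ (-η) * (N : ℝ) ^ (1 : ℝ) * (N : ℝ) ^ (η / 4)) := by
          rw [rpow_one]; ring
      _ = 3 * C * D * (N : ℝ) ^ (-η + 1 + η / 4) := by rw [← rpow_add hN0, ← rpow_add hN0]
      _ ≤ _ := by
          rw [hW]
          gcongr
          linarith
  have t3 : 2 * N * Lg ^ 3 * √(6 * (N : ℝ) ^ (-(1 / 16) : ℝ) + 4 * (C * (N : ℝ) ^ (-η))) ≤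
      2 * D * √(6 + 4 * C) * W := by
    have hs : √(6 * (N : ℝ) ^ (-(1 / 16) : ℝ) + 4 * (C * (N : ℝ) ^ (-η))) ≤
        √(6 + 4 * C) * (N : ℝ) ^ (-(η / 2)) := by
      rw [sqrt_le_left (by positivity), mul_pow, sq_sqrt (by positivity), ← rpow_natCast,
        ← rpow_mul hN0.le]
      have e : -(η / 2) * ((2 : ℕ) : ℝ) = -η := by push_cast; ring
      rw [e]
      have : (N : ℝ) ^ (-(1 / 16) : ℝ) ≤ (N : ℝ) ^ (-η) :=
        rpow_le_rpow_of_exponent_le hN1 (by linarith)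
      linarith
    calc _ ≤ 2 * N * (D * (N : ℝ) ^ (η / 4)) * (√(6 + 4 * C) * (N : ℝ) ^ (-(η / 2))) := by gcongr
      _ = 2 * D * √(6 + 4 * C) *
          ((N : ℝ) ^ (1 : ℝ) * (N : ℝ) ^ (η / 4) * (N : ℝ) ^ (-(η / 2))) := by
          rw [rpow_one]; ring
      _ = _ := by
          rw [← rpow_add hN0, ← rpow_add hN0, hW]
          congr 2; ring
  linarith

/-! ### From exponential sums to equidistribution in arcs -/

lemma ePhase_eq_one_iff {x : ℝ} : ePhase x = 1 ↔ ∃ k : ℤ, x = k := by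
  constructor
  · intro h
    rw [ePhase, Complex.exp_eq_one_iff] at h
    obtain ⟨k, hk⟩ := h
    refine ⟨k, ?_⟩
    have h2 : ((2 * π * x : ℝ) : ℂ) = ((k * (2 * π) : ℝ) : ℂ) := by
      apply mul_right_cancel₀ Complex.I_ne_zero
      rw [hk]
      push_cast
      ring
    have h3 : 2 * π * x = k * (2 * π) := by exact_mod_cast h2
    have := pi_pos
    nlinarith
  · rintro ⟨k, rfl⟩
    exact ePhase_int k

/-- The Dirichlet-type kernel `∑_{r < H} e (r x)`. -/
noncomputable def expKernel (H : ℕ) (x : ℝ) : ℂ := ∑ r ∈ range H, ePhase (r * x)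

lemma expKernel_add_int (H : ℕ) (x : ℝ) (k : ℤ) : expKernel H (x + k) = expKernel H x := by
  refine sum_congr rfl fun r _ => ?_
  rw [mul_add]
  have : (r : ℝ) * k = ((r * k : ℤ) : ℝ) := by push_cast; rfl
  rw [this, ePhase_add_int]

lemma norm_expKernel_le {H : ℕ} {x D : ℝ} (j : ℤ) (hD : 0 < D) (h1 : j + D ≤ x)
    (h2 : x ≤ j + 1 - D) : ‖expKernel H x‖ ≤ 1 / (2 * D) := by
  have h3 := le_norm_one_sub_ePhase j hD.le h1 h2
  have h4 : expKernel H x * (1 - ePhase x) = 1 - ePhase (H * x) := by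
    simp only [expKernel, ePhase_nat_mul]
    exact geom_sum_mul_neg _ _
  have h5 : ‖expKernel H x‖ * ‖1 - ePhase x‖ ≤ 2 := by
    rw [← norm_mul, h4]
    refine (norm_sub_le _ _).trans ?_
    rw [norm_one, norm_ePhase]
    norm_num
  rw [le_div_iff₀ (by positivity)]
  have := mul_le_mul_of_nonneg_left h3 (norm_nonneg (expKernel H x))
  linarith

lemma norm_expKernel_sq (H : ℕ) (x : ℝ) : ((‖expKernel H x‖ ^ 2 : ℝ) : ℂ) =
    ∑ r ∈ range H, ∑ s ∈ range H, ePhase (((r : ℝ) - s) * x) := by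
  push_cast
  rw [← Complex.mul_conj', expKernel, map_sum, sum_mul_sum]
  refine sum_congr rfl fun r _ => sum_congr rfl fun s _ => ?_
  rw [sub_mul, ePhase_sub]

/-- Orthogonality of characters modulo `H`. After division by `H ^ 2`, the squared kernels centred
at the `H` equally spaced points form a partition of unity on the circle. -/
lemma sum_norm_expKernel_sq {H : ℕ} (hH : 0 < H) (y : ℝ) :
    ∑ i ∈ range H, ‖expKernel H (y - i / H)‖ ^ 2 = (H : ℝ) ^ 2 := by
  have hH0 : (H : ℝ) ≠ 0 := by positivity
  have h : ((∑ i ∈ range H, ‖expKernel H (y - i / H)‖ ^ 2 : ℝ) : ℂ) = ((H : ℝ) ^ 2 : ℝ) := by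
    rw [Complex.ofReal_sum]
    simp only [norm_expKernel_sq]
    rw [sum_comm]
    have : ∀ r ∈ range H, ∑ i ∈ range H, ∑ s ∈ range H, ePhase (((r : ℝ) - s) * (y - i / H)) =
        (H : ℂ) := by
      intro r hr
      rw [sum_comm]
      have : ∀ s ∈ range H, ∑ i ∈ range H, ePhase (((r : ℝ) - s) * (y - i / H)) =
          if s = r then (H : ℂ) else 0 := by
        intro s hs
        split_ifs with h
        · subst h; simp
        · set ω := ePhase (-(((r : ℝ) - s) / H)) with hω
          have h1 : ∀ i ∈ range H, ePhase (((r : ℝ) - s) * (y - i / H)) =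
              ePhase (((r : ℝ) - s) * y) * ω ^ i := by
            intro i _
            rw [hω, ← ePhase_nat_mul, ← ePhase_add]
            congr 1
            ring
          rw [sum_congr rfl h1, ← mul_sum]
          have hωH : ω ^ H = 1 := by
            rw [hω, ← ePhase_nat_mul, ePhase_eq_one_iff]
            refine ⟨s - r, ?_⟩
            push_cast
            field_simp
            ring
          have hω1 : ω ≠ 1 := by
            rw [hω, Ne, ePhase_eq_one_iff]
            rintro ⟨k, hk⟩
            have h2 : (s : ℝ) - r = k * H := by
              rw [← hk]; field_simp; ring
            have h3 : (s : ℤ) - r = k * H := by exact_mod_cast h2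
            have hs := mem_range.1 hs
            have hr := mem_range.1 hr
            have h4 : (H : ℤ) ∣ (s : ℤ) - r := ⟨k, by rw [h3, mul_comm]⟩
            have h5 := Int.eq_zero_of_abs_lt_dvd h4 (by rw [abs_lt]; constructor <;> omega)
            omega
          have h2 := geom_sum_mul ω H
          rw [hωH, sub_self] at h2
          rw [(mul_eq_zero.1 h2).resolve_right (sub_ne_zero.2 hω1), mul_zero]
      rw [sum_congr rfl this, sum_ite_eq', if_pos hr]
    rw [sum_congr rfl this]
    simp
    ring
  exact_mod_cast h

lemma norm_sum_mul_ePhase_neg {ι : Type*} (S : Finset ι) (w x : ι → ℝ) :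
    ‖∑ n ∈ S, (w n : ℂ) * ePhase (-x n)‖ = ‖∑ n ∈ S, (w n : ℂ) * ePhase (x n)‖ := by
  rw [← RCLike.norm_conj (∑ n ∈ S, (w n : ℂ) * ePhase (x n)), map_sum]
  simp only [map_mul, Complex.conj_ofReal, ePhase_neg]

/-- Opening the square gives `H` diagonal terms equal to the total mass, and off-diagonal sums of
frequency `|r - s| < H`. -/
lemma sum_mul_norm_expKernel_sq_le {ι : Type*} {S : Finset ι} {w x : ι → ℝ} {H : ℕ} {E : ℝ}
    (hw : ∀ n ∈ S, 0 ≤ w n)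
    (hE : ∀ k : ℕ, 1 ≤ k → k < H → ‖∑ n ∈ S, (w n : ℂ) * ePhase (k * x n)‖ ≤ E) (hE0 : 0 ≤ E)
    (t : ℝ) : ∑ n ∈ S, w n * ‖expKernel H (x n - t)‖ ^ 2 ≤
      H * (∑ n ∈ S, w n) + H ^ 2 * E := by
  set W := ∑ n ∈ S, w n with hW
  have hW0 : 0 ≤ W := sum_nonneg hw
  have h : ((∑ n ∈ S, w n * ‖expKernel H (x n - t)‖ ^ 2 : ℝ) : ℂ) =
      ∑ r ∈ range H, ∑ s ∈ range H, ePhase (-(((r : ℝ) - s) * t)) *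
        ∑ n ∈ S, (w n : ℂ) * ePhase (((r : ℝ) - s) * x n) := by
    rw [Complex.ofReal_sum]
    simp only [Complex.ofReal_mul, norm_expKernel_sq, mul_sum]
    rw [sum_comm]
    refine sum_congr rfl fun r _ => ?_
    rw [sum_comm]
    refine sum_congr rfl fun s _ => sum_congr rfl fun n _ => ?_
    rw [mul_left_comm, ← ePhase_add]
    ring_nf
  have h0 : 0 ≤ ∑ n ∈ S, w n * ‖expKernel H (x n - t)‖ ^ 2 :=
    sum_nonneg fun n hn => mul_nonneg (hw n hn) (by positivity)
  have hterm : ∀ r ∈ range H, ∀ s ∈ range H, ‖ePhase (-(((r : ℝ) - s) * t)) *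
      ∑ n ∈ S, (w n : ℂ) * ePhase (((r : ℝ) - s) * x n)‖ ≤ (if r = s then W else 0) + E := by
    intro r hr s hs
    have hr := mem_range.1 hr
    have hs := mem_range.1 hs
    rw [norm_mul, norm_ePhase, one_mul]
    rcases lt_trichotomy r s with h1 | h1 | h1
    · rw [if_neg h1.ne, zero_add, ← norm_sum_mul_ePhase_neg]
      refine le_trans (le_of_eq ?_) (hE (s - r) (by omega) (by omega))
      congr 1
      refine sum_congr rfl fun n _ => ?_
      rw [Nat.cast_sub h1.le]
      ring_nf
    · subst h1
      rw [if_pos rfl]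
      have : ‖∑ n ∈ S, (w n : ℂ) * ePhase (((r : ℝ) - r) * x n)‖ = W := by
        simp only [sub_self, zero_mul, ePhase_zero, mul_one]
        rw [← Complex.ofReal_sum, Complex.norm_real, norm_of_nonneg hW0]
      linarith
    · rw [if_neg h1.ne', zero_add]
      refine le_trans (le_of_eq ?_) (hE (r - s) (by omega) (by omega))
      congr 1
      refine sum_congr rfl fun n _ => ?_
      rw [Nat.cast_sub h1.le]
  calc _ = ‖((∑ n ∈ S, w n * ‖expKernel H (x n - t)‖ ^ 2 : ℝ) : ℂ)‖ := by
        rw [Complex.norm_real, norm_of_nonneg h0]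
    _ ≤ ∑ r ∈ range H, ∑ s ∈ range H, ((if r = s then W else 0) + E) := by
        rw [h]
        exact (norm_sum_le _ _).trans (sum_le_sum fun r hr =>
          (norm_sum_le _ _).trans (sum_le_sum fun s hs => hterm r hr s hs))
    _ = _ := by
        simp only [sum_add_distrib, sum_const, card_range, nsmul_eq_mul]
        rw [sum_congr rfl (g := fun _ => W)]
        · simp; ring
        · intro r hr
          rw [sum_ite_eq, if_pos hr]

/-- The arc is majorised by the part of the partition of unity centred within `D` of it. The omitted
kernels are small on the arc, and their total is the term `1 / (4 * H * D ^ 2)`. -/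
lemma sum_fract_lt_le {ι : Type*} {S : Finset ι} {w x : ι → ℝ} {H : ℕ} {E l D : ℝ} (hH : 0 < H)
    (hw : ∀ n ∈ S, 0 ≤ w n)
    (hE : ∀ k : ℕ, 1 ≤ k → k < H → ‖∑ n ∈ S, (w n : ℂ) * ePhase (k * x n)‖ ≤ E) (hE0 : 0 ≤ E)
    (hl : 0 ≤ l) (hD : 0 < D) :
    ∑ n ∈ S with Int.fract (x n) < l, w n ≤
      (l + 2 * D + 1 / H + 1 / (4 * H * D ^ 2)) * (∑ n ∈ S, w n) + H * E := by
  set W := ∑ n ∈ S, w n with hW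
  have hW0 : 0 ≤ W := sum_nonneg hw
  have hH0 : (0 : ℝ) < H := by exact_mod_cast hH
  by_cases hbig : 1 ≤ l + 2 * D
  · have h1 : ∑ n ∈ S with Int.fract (x n) < l, w n ≤ W :=
      sum_le_sum_of_subset_of_nonneg (filter_subset _ _) fun n hn _ => hw n hn
    have h2 : 1 ≤ l + 2 * D + 1 / H + 1 / (4 * H * D ^ 2) := by
      have : (0 : ℝ) ≤ 1 / H + 1 / (4 * H * D ^ 2) := by positivity
      linarith
    have h3 : 0 ≤ H * E := by positivity
    nlinarith
  push Not at hbig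
  -- The centres `t i` run once around the circle, starting at the first multiple of `1 / H` not
  -- below `-D`. Those beyond `l + D` are at most `1 - D`, hence at distance at least `D` from the
  -- arc modulo 1.
  set a : ℤ := ⌈-(D * H)⌉ with ha
  have ha1 : -(D * H) ≤ a := Int.le_ceil _
  have ha2 : (a : ℝ) < -(D * H) + 1 := Int.ceil_lt_add_one _
  set t : ℕ → ℝ := fun i => (a + i) / H with ht
  set J := (range H).filter (fun i => t i ≤ l + D) with hJ
  have hJcard : (J.card : ℝ) ≤ (l + 2 * D) * H + 1 := by
    have hsub : J ⊆ range (⌊(l + 2 * D) * H⌋₊ + 1) := by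
      intro i hi
      rw [hJ, mem_filter, ht] at hi
      rw [mem_range, Nat.lt_succ_iff]
      apply Nat.le_floor
      have := hi.2
      simp only at this
      rw [div_le_iff₀ hH0] at this
      linarith
    have h1 := card_le_card hsub
    rw [card_range] at h1
    have h2 := Nat.floor_le (show 0 ≤ (l + 2 * D) * H by positivity)
    have h3 : (J.card : ℝ) ≤ (⌊(l + 2 * D) * H⌋₊ : ℝ) + 1 := by exact_mod_cast h1
    linarith
  have hJH : (J.card : ℝ) ≤ H := by
    have := card_le_card (filter_subset (fun i => t i ≤ l + D) (range H))
    rw [card_range] at this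
    exact_mod_cast this
  have hpoint : ∀ y : ℝ, Int.fract y < l →
      1 ≤ 1 / (H : ℝ) ^ 2 * ∑ i ∈ J, ‖expKernel H (y - t i)‖ ^ 2 + 1 / (4 * H * D ^ 2) := by
    intro y hy
    have hfull : ∑ i ∈ range H, ‖expKernel H (y - t i)‖ ^ 2 = (H : ℝ) ^ 2 := by
      rw [← sum_norm_expKernel_sq hH (y - a / H)]
      refine sum_congr rfl fun i _ => ?_
      simp only [ht, add_div, sub_sub]
    rw [← sum_filter_add_sum_filter_not (range H) (fun i => t i ≤ l + D)] at hfull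
    have hrest : ∑ i ∈ range H with ¬ t i ≤ l + D, ‖expKernel H (y - t i)‖ ^ 2 ≤
        H * (1 / (4 * D ^ 2)) := by
      have hb : ∀ i ∈ (range H).filter (fun i => ¬ t i ≤ l + D),
          ‖expKernel H (y - t i)‖ ^ 2 ≤ 1 / (4 * D ^ 2) := by
        intro i hi
        rw [mem_filter, mem_range, not_le] at hi
        have e : y - t i = (Int.fract y - t i) + (⌊y⌋ : ℤ) := by
          have := Int.floor_add_fract y
          linarith
        have ht1 : t i ≤ 1 - D := by
          rw [ht]
          simp only
          rw [div_le_iff₀ hH0]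
          have : (i : ℝ) + 1 ≤ H := by exact_mod_cast hi.1
          nlinarith
        have hf := Int.fract_nonneg y
        rw [e, expKernel_add_int]
        have := norm_expKernel_le (H := H) (x := Int.fract y - t i) (-1) hD
          (by push_cast; linarith) (by push_cast; linarith)
        calc ‖expKernel H (Int.fract y - t i)‖ ^ 2 ≤ (1 / (2 * D)) ^ 2 := by gcongr
          _ = _ := by field_simp; norm_num
      refine (sum_le_card_nsmul _ _ _ hb).trans ?_
      rw [nsmul_eq_mul]
      gcongr
      have := card_le_card (filter_subset (fun i => ¬ t i ≤ l + D) (range H))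
      rwa [card_range] at this
    have h1 : (H : ℝ) ^ 2 ≤ ∑ i ∈ J, ‖expKernel H (y - t i)‖ ^ 2 + H * (1 / (4 * D ^ 2)) := by
      linarith
    calc (1 : ℝ) = 1 / (H : ℝ) ^ 2 * (H : ℝ) ^ 2 := by field_simp
      _ ≤ 1 / (H : ℝ) ^ 2 * (∑ i ∈ J, ‖expKernel H (y - t i)‖ ^ 2 + H * (1 / (4 * D ^ 2))) := by
          gcongr
      _ = _ := by field_simp
  have hmaj : ∑ n ∈ S with Int.fract (x n) < l, w n ≤
      ∑ n ∈ S, w n * (1 / (H : ℝ) ^ 2 * ∑ i ∈ J, ‖expKernel H (x n - t i)‖ ^ 2 +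
        1 / (4 * H * D ^ 2)) := by
    rw [sum_filter]
    refine sum_le_sum fun n hn => ?_
    split_ifs with h
    · exact le_mul_of_one_le_right (hw n hn) (hpoint _ h)
    · exact mul_nonneg (hw n hn) (by positivity)
  refine hmaj.trans ?_
  have hswap : ∑ n ∈ S, w n * (1 / (H : ℝ) ^ 2 * ∑ i ∈ J, ‖expKernel H (x n - t i)‖ ^ 2 +
        1 / (4 * H * D ^ 2)) =
      1 / (H : ℝ) ^ 2 * ∑ i ∈ J, ∑ n ∈ S, w n * ‖expKernel H (x n - t i)‖ ^ 2 +
        1 / (4 * H * D ^ 2) * W := by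
    rw [sum_comm, hW, mul_sum, mul_sum, ← sum_add_distrib]
    refine sum_congr rfl fun n _ => ?_
    rw [← mul_sum]
    ring
  rw [hswap]
  have hJsum : ∑ i ∈ J, ∑ n ∈ S, w n * ‖expKernel H (x n - t i)‖ ^ 2 ≤
      J.card * (H * W + H ^ 2 * E) := by
    refine (sum_le_card_nsmul _ _ _ fun i _ =>
      sum_mul_norm_expKernel_sq_le hw hE hE0 (t i)).trans (le_of_eq ?_)
    rw [nsmul_eq_mul]
  calc _ ≤ 1 / (H : ℝ) ^ 2 * (J.card * (H * W + H ^ 2 * E)) + 1 / (4 * H * D ^ 2) * W := by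
        gcongr
    _ = J.card * (W / H) + J.card * E + 1 / (4 * H * D ^ 2) * W := by field_simp
    _ ≤ ((l + 2 * D) * H + 1) * (W / H) + H * E + 1 / (4 * H * D ^ 2) * W := by gcongr
    _ = _ := by field_simp; ring

lemma norm_sum_mul_ePhase_shift {ι : Type*} (S : Finset ι) (w x : ι → ℝ) (k y : ℝ) :
    ‖∑ n ∈ S, (w n : ℂ) * ePhase (k * (x n - y))‖ =
      ‖∑ n ∈ S, (w n : ℂ) * ePhase (k * x n)‖ := by
  have : ∑ n ∈ S, (w n : ℂ) * ePhase (k * (x n - y)) =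
      ePhase (-(k * y)) * ∑ n ∈ S, (w n : ℂ) * ePhase (k * x n) := by
    rw [mul_sum]
    refine sum_congr rfl fun n _ => ?_
    rw [mul_left_comm, ← ePhase_add]
    ring_nf
  rw [this, norm_mul, norm_ePhase, one_mul]

/-- The complement of the arc is a translate of `[0, 1 - l)`. The upper bound applied to it yields
the lower bound for the arc. -/
lemma fract_sub_lt_iff {x l : ℝ} (hl0 : 0 ≤ l) (hl1 : l ≤ 1) :
    Int.fract (x - l) < 1 - l ↔ ¬ Int.fract x < l := by
  have h0 := Int.fract_nonneg x
  have h1 := Int.fract_lt_one x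
  have h2 := Int.floor_add_fract x
  rw [not_lt]
  by_cases h : l ≤ Int.fract x
  · have : Int.fract (x - l) = Int.fract x - l :=
      Int.fract_eq_iff.2 ⟨by linarith, by linarith, ⌊x⌋, by linarith⟩
    rw [this]
    exact ⟨fun _ => h, fun _ => by linarith⟩
  · have hlt := not_le.1 h
    have : Int.fract (x - l) = Int.fract x - l + 1 :=
      Int.fract_eq_iff.2 ⟨by linarith, by linarith, ⌊x⌋ - 1, by push_cast; linarith⟩
    rw [this]
    constructor <;> intro h' <;> linarith

/-- Weighted equidistribution of an arc, from bounds on exponential sums. -/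
lemma abs_sum_fract_lt_sub_le {ι : Type*} {S : Finset ι} {w x : ι → ℝ} {H : ℕ} {E l D : ℝ}
    (hH : 0 < H) (hw : ∀ n ∈ S, 0 ≤ w n)
    (hE : ∀ k : ℕ, 1 ≤ k → k < H → ‖∑ n ∈ S, (w n : ℂ) * ePhase (k * x n)‖ ≤ E) (hE0 : 0 ≤ E)
    (hl : 0 ≤ l) (hl1 : l ≤ 1) (hD : 0 < D) :
    |∑ n ∈ S with Int.fract (x n) < l, w n - l * ∑ n ∈ S, w n| ≤
      (2 * D + 1 / H + 1 / (4 * H * D ^ 2)) * (∑ n ∈ S, w n) + H * E := by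
  have h1 := sum_fract_lt_le hH hw hE hE0 hl hD
  have h2 := sum_fract_lt_le (x := fun n => x n - l) hH hw
    (fun k hk hk' => (norm_sum_mul_ePhase_shift S w x k l).trans_le (hE k hk hk')) hE0
    (show 0 ≤ 1 - l by linarith) hD
  simp only [fract_sub_lt_iff hl hl1] at h2
  have h3 := sum_filter_add_sum_filter_not S (fun n => Int.fract (x n) < l) w
  rw [abs_le]
  constructor <;> linarith

/-! ### Residues of `⌊n^c⌋` and the conclusion -/

lemma floor_modEq_iff_fract_lt {y : ℝ} (hy : 0 ≤ y) {m u : ℕ} (hm : 0 < m) :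
    ⌊y⌋₊ ≡ u [MOD m] ↔ Int.fract ((y - u) / m) < 1 / m := by
  have hm0 : (0 : ℝ) < m := by exact_mod_cast hm
  have hfl : ((⌊y⌋₊ : ℕ) : ℤ) = ⌊y⌋ := Int.natCast_floor_eq_floor hy
  rw [Nat.ModEq.comm, ← Int.natCast_modEq_iff, Int.modEq_iff_dvd, hfl]
  constructor
  · rintro ⟨k, hk⟩
    have hk' : (⌊y⌋ : ℝ) - u = m * k := by exact_mod_cast hk
    have h1 : Int.fract ((y - u) / m) = Int.fract y / m := by
      rw [Int.fract_eq_iff]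
      have h0 := Int.fract_nonneg y
      have h2 := Int.fract_lt_one y
      have h3 : (1 : ℝ) ≤ m := by exact_mod_cast hm
      refine ⟨by positivity, by rw [div_lt_one hm0]; linarith, k, ?_⟩
      rw [← sub_div, div_eq_iff hm0.ne', ← Int.self_sub_floor]
      linarith
    rw [h1]
    gcongr
    exact Int.fract_lt_one y
  · intro h
    set k := ⌊(y - u) / m⌋ with hk
    have h0 := Int.fract_nonneg ((y - u) / m)
    rw [← Int.self_sub_floor, ← hk] at h0 h
    have h1 : (k : ℝ) * m ≤ y - u := by
      rw [← le_div_iff₀ hm0]; linarith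
    have h2 : y - u < k * m + 1 := by
      have : (y - u) / m < (k * m + 1) / m := by
        rw [add_div, mul_div_cancel_right₀ _ hm0.ne']; linarith
      exact (div_lt_div_iff_of_pos_right hm0).1 this
    refine ⟨k, ?_⟩
    have : ⌊y⌋ = u + m * k := by
      rw [Int.floor_eq_iff]
      push_cast
      constructor <;> linarith
    rw [this]
    ring

/-- Power-saving equidistribution of `⌊n ^ c⌋` modulo `m`, weighted by `Λ`. -/
theorem exists_abs_sum_floor_modEq_sub_le {c : ℝ} (hc : 1 < c) (hcZ : ∀ k : ℤ, c ≠ k) :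
    ∃ ρ : ℝ, 0 < ρ ∧ ρ ≤ 1 ∧ ∃ C : ℝ, 0 ≤ C ∧ ∀ N m u : ℕ, 1 ≤ N → 1 ≤ m →
      (m : ℝ) ≤ (N : ℝ) ^ ρ →
        |∑ n ∈ (Ioc 0 N).filter (fun n : ℕ => ⌊(n : ℝ) ^ c⌋₊ ≡ u [MOD m]), Λ n - 1 / m * ∑ n ∈ Ioc 0 N, Λ n| ≤
          C * (N : ℝ) ^ (1 - ρ) := by
  obtain ⟨θ, hθ, η, hη, hη1, C, hC0, hC⟩ := exists_norm_sum_vonMangoldt_le hc hcZ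
  set κ := min θ (η / 2) with hκ
  have hκ0 : 0 < κ := lt_min hθ (by positivity)
  have hκ1 : κ ≤ θ := min_le_left _ _
  have hκ2 : κ ≤ η / 2 := min_le_right _ _
  -- With `H` about `N ^ κ` and `D = N ^ (-κ/3)`, the errors `D` and `1 / (H * D ^ 2)` balance. The
  -- choice `κ ≤ η / 2` keeps `H * N ^ (1 - η)` below the same order, and `κ ≤ θ` keeps all `k / m`
  -- in the admissible range.
  refine ⟨κ / 3, by positivity, by linarith, 20 + 2 * C, by positivity, ?_⟩
  intro N m u hN hm hmN
  have hN1 : (1 : ℝ) ≤ N := by exact_mod_cast hN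
  have hN0 : (0 : ℝ) < N := by linarith
  have hm1 : (1 : ℝ) ≤ m := by exact_mod_cast hm
  have hm0 : (0 : ℝ) < m := by linarith
  set H := ⌈(N : ℝ) ^ κ⌉₊ with hH
  have hNκ : 1 ≤ (N : ℝ) ^ κ := one_le_rpow hN1 hκ0.le
  have hH1 : (N : ℝ) ^ κ ≤ H := Nat.le_ceil _
  have hH2 : (H : ℝ) ≤ 2 * (N : ℝ) ^ κ := by
    have := Nat.ceil_lt_add_one (show 0 ≤ (N : ℝ) ^ κ by positivity)
    linarith
  have hH0 : 0 < H := Nat.ceil_pos.2 (by positivity)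
  have hH0r : (0 : ℝ) < H := by exact_mod_cast hH0
  set r := (N : ℝ) ^ (-(κ / 3)) with hr
  have hr0 : 0 < r := by positivity
  have hr3 : (N : ℝ) ^ κ * r ^ 3 = 1 := by
    rw [hr, ← rpow_natCast, ← rpow_mul hN0.le, ← rpow_add hN0]
    norm_num
  have hr1 : r ≤ 1 := rpow_le_one_of_one_le_of_nonpos hN1 (by linarith)
  have hexp : ∀ k : ℕ, 1 ≤ k → k < H → ‖∑ n ∈ Ioc 0 N, (Λ n : ℂ) *
      ePhase (k * (((n : ℝ) ^ c - u) / m))‖ ≤ C * (N : ℝ) ^ (1 - η) := by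
    intro k hk hkH
    have hk1 : (1 : ℝ) ≤ k := by exact_mod_cast hk
    have e : ∀ n : ℕ, (k : ℝ) * (((n : ℝ) ^ c - u) / m) = (k / m : ℝ) * ((n : ℝ) ^ c - u) :=
      fun n => by ring
    simp only [e]
    rw [norm_sum_mul_ePhase_shift (Ioc 0 N) (fun n => Λ n) (fun n => (n : ℝ) ^ c)]
    apply hC N _ hN
    · rw [le_div_iff₀ hm0]
      calc (N : ℝ) ^ (-θ) * m ≤ (N : ℝ) ^ (-θ) * (N : ℝ) ^ (κ / 3) := by gcongr
        _ = (N : ℝ) ^ (-θ + κ / 3) := by rw [← rpow_add hN0]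
        _ ≤ 1 := rpow_le_one_of_one_le_of_nonpos hN1 (by linarith)
        _ ≤ k := hk1
    · calc (k : ℝ) / m ≤ k := div_le_self (by positivity) hm1
        _ ≤ (N : ℝ) ^ κ := (Nat.lt_ceil.1 hkH).le
        _ ≤ _ := rpow_le_rpow_of_exponent_le hN1 hκ1
  have key := abs_sum_fract_lt_sub_le (S := Ioc 0 N) (w := fun n => Λ n)
    (x := fun n : ℕ => ((n : ℝ) ^ c - u) / m) (l := 1 / m) (D := r) hH0
    (fun n _ => ArithmeticFunction.vonMangoldt_nonneg) hexp (by positivity) (by positivity)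
    (by rw [div_le_one hm0]; exact hm1) hr0
  have hfilter : (Ioc 0 N).filter (fun n : ℕ => ⌊(n : ℝ) ^ c⌋₊ ≡ u [MOD m]) =
      (Ioc 0 N).filter (fun n : ℕ => Int.fract (((n : ℝ) ^ c - u) / m) < 1 / m) :=
    filter_congr fun n _ => floor_modEq_iff_fract_lt (by positivity) hm
  rw [hfilter]
  refine key.trans ?_
  have hW : (N : ℝ) * r = (N : ℝ) ^ (1 - κ / 3) := by
    rw [hr, sub_eq_add_neg, rpow_add hN0, rpow_one]
  have b1 : 1 / (H : ℝ) ≤ r ^ 3 := by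
    rw [div_le_iff₀ hH0r, ← hr3, mul_comm]
    gcongr
  have b2 : 1 / (4 * H * r ^ 2) ≤ r / 4 := by
    calc 1 / (4 * H * r ^ 2) = 1 / H * (1 / (4 * r ^ 2)) := by field_simp
      _ ≤ r ^ 3 * (1 / (4 * r ^ 2)) := by gcongr
      _ = r / 4 := by field_simp
  have b3 : r ^ 3 ≤ r := by
    simpa using pow_le_pow_of_le_one hr0.le hr1 (show 1 ≤ 3 by norm_num)
  have b4 : (H : ℝ) * (C * (N : ℝ) ^ (1 - η)) ≤ 2 * C * (N : ℝ) ^ (1 - κ / 3) := by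
    calc _ ≤ 2 * (N : ℝ) ^ κ * (C * (N : ℝ) ^ (1 - η)) := by gcongr
      _ = 2 * C * (N : ℝ) ^ (κ + (1 - η)) := by rw [rpow_add hN0]; ring
      _ ≤ _ := by
          apply mul_le_mul_of_nonneg_left _ (by positivity)
          exact rpow_le_rpow_of_exponent_le hN1 (by linarith)
  calc _ ≤ (2 * r + r + r / 4) * (6 * N) + 2 * C * (N : ℝ) ^ (1 - κ / 3) := by
        refine add_le_add (mul_le_mul (by linarith) (sum_vonMangoldt_le N)
          (sum_nonneg fun _ _ => ArithmeticFunction.vonMangoldt_nonneg) (by positivity)) b4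
    _ = 19.5 * (N * r) + 2 * C * (N : ℝ) ^ (1 - κ / 3) := by ring
    _ ≤ _ := by
        rw [hW, add_mul]
        gcongr
        norm_num

end

open Finset Real in
theorem mainTheorem11 (c : ℝ) (hc : 1 < c) (hcZ : ∀ k : ℤ, c ≠ (k : ℝ)) :
    ∃ θ : ℝ, 0 < θ ∧ ∃ δ : ℝ, 0 < δ ∧ ∃ C : ℝ, ∀ N m u : ℕ,
      1 ≤ m → (m : ℝ) ≤ (N : ℝ) ^ θ → u < m →
        |(∑ n ∈ (Finset.Icc 1 N).filter (fun n : ℕ => ⌊(n : ℝ) ^ c⌋₊ ≡ u [MOD m]),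
              ArithmeticFunction.vonMangoldt n)
            - Chebyshev.psi (N : ℝ) / (m : ℝ)|
          ≤ C * ((N : ℝ) / (m : ℝ)) ^ (1 - δ) := by
  obtain ⟨ρ, hρ, hρ1, C, hC0, hC⟩ := exists_abs_sum_floor_modEq_sub_le hc hcZ
  -- For `m ≤ N ^ (ρ/2)` one has `N / m ≥ N ^ (1 - ρ/2)`, and `(1 - ρ/2)^2 ≥ 1 - ρ`. So `N ^ (1 -
  -- ρ)` is at most `(N / m) ^ (1 - ρ/2)`.
  refine ⟨ρ / 2, by positivity, ρ / 2, by positivity, C, ?_⟩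
  intro N m u hm hmN _
  have hm0 : (0 : ℝ) < m := by exact_mod_cast hm
  -- The case `N = 0` is vacuous, as `0` raised to a positive power is `0 < m`.
  have hN : 1 ≤ N := by
    by_contra h
    have : N = 0 := by omega
    rw [this, Nat.cast_zero, zero_rpow (by positivity)] at hmN
    linarith
  have hN1 : (1 : ℝ) ≤ N := by exact_mod_cast hN
  have hN0 : (0 : ℝ) < N := by linarith
  have hI : Icc 1 N = Ioc 0 N := by ext n; rw [mem_Icc, mem_Ioc]; omega
  have hmain := hC N m u hN hm (hmN.trans (rpow_le_rpow_of_exponent_le hN1 (by linarith)))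
  rw [hI, Chebyshev.psi, Nat.floor_natCast, div_eq_mul_one_div, mul_comm _ (1 / (m : ℝ))]
  refine hmain.trans (mul_le_mul_of_nonneg_left ?_ hC0)
  have h1 : (N : ℝ) ^ (1 - ρ / 2) ≤ N / m := by
    rw [le_div_iff₀ hm0]
    calc (N : ℝ) ^ (1 - ρ / 2) * m ≤ (N : ℝ) ^ (1 - ρ / 2) * (N : ℝ) ^ (ρ / 2) := by gcongr
      _ = N := by rw [← rpow_add hN0]; simp
  calc (N : ℝ) ^ (1 - ρ) ≤ (N : ℝ) ^ ((1 - ρ / 2) * (1 - ρ / 2)) :=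
        rpow_le_rpow_of_exponent_le hN1 (by nlinarith)
    _ = ((N : ℝ) ^ (1 - ρ / 2)) ^ (1 - ρ / 2) := rpow_mul hN0.le _ _
    _ ≤ _ := rpow_le_rpow (by positivity) h1 (by linarith)
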